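/- Fix $N\ge 1$ edge types and a finite loopless multigraph $G_0$ (the deterministic initial configuration) whose edges are typed by $[N]=\{1,\dots,N\}$ and which has at least one edge of each type. For a typed multigraph sequence $(G_n)$, let $V_n$, $E_n$, $E_n^{(k)}$ be the vertex set, the edge set and the set of edges of type $k$ of $G_n$, let $\deg_n^{(k)}(v)$ be the number of edges of type $k$ at $v\in V_n$, let $X_n(\boldsymbol d)$ be the number of vertices $v\in V_n$ with $(\deg_n^{(1)}(v),\dots,\deg_n^{(N)}(v))=\boldsymbol d$, and let $\mathcal F_n$ be the $\sigma$-algebra generated by $G_1,\dots,G_n$ ($\mathcal F_0$ is trivial). Model of independent edges: let $\lambda_1,\lambda_2,\dots$ be independent random variables. For every $n\ge 1$, in step $n$ a new vertex $v_n$ is added to $G_{n-1}$, all old edges are kept, and all new edges join $v_n$ to vertices of $V_{n-1}$; conditionally on $\mathcal F_{n-1}^+=\sigma(\mathcal F_{n-1},\lambda_n)$, the numbers $\Delta_n^{(k)}(w)$ of new edges of type $k$ between $v_n$ and $w$ ($k\in[N]$, $w\in V_{n-1}$) are independent, and $\Delta_n^{(k)}(w)$ has the Poisson distribution with parameter $\lambda_n\deg_{n-1}^{(k)}(w)/(2|E_{n-1}|)$.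 Assume: (IE1) for every $n\ge1$, $\lambda_n$ is (almost surely) positive and independent of $\mathcal F_{n-1}$; (IE2) there is an (almost surely) positive random variable $\lambda$ such that $\lambda_n\to\lambda$ in distribution and, for every integer $p\ge 1$, $\mathbb E(\lambda_n^p)\to\mathbb E(\lambda^p)<\infty$ as $n\to\infty$. Then there are random variables $\hat\zeta^{(k)}$ ($k\in[N]$) and $x(\boldsymbol d)$ ($\boldsymbol d\in\mathbb Z_{\ge0}^N$) such that, almost surely as $n\to\infty$, $$\frac{|E_n^{(k)}|}{|E_n|}\to\hat\zeta^{(k)}\quad(k\in[N]),\qquad \frac{X_n(\boldsymbol d)}{|V_n|}\to x(\boldsymbol d)\quad(\boldsymbol d\in\mathbb Z_{\ge0}^N),$$ and for every $\boldsymbol d=(d_1,\dots,d_N)\in\mathbb Z_{\ge0}^N$, with $D=\sum_{k=1}^N d_k$, almost surely $$x(\boldsymbol d)=\sum_{k=1}^{N}\frac{d_k-1}{D+2}\,x(\boldsymbol d-\boldsymbol e_k)+\frac{2}{D+2}\,\frac{\prod_{k=1}^N\bigl(\hat\zeta^{(k)}\bigr)^{d_k}}{\prod_{k=1}^N d_k!}\,\mathbb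 E\bigl(\lambda^{D}e^{-\lambda}\bigr),$$ where $\boldsymbol e_k$ is the $k$-th unit vector and $x(\boldsymbol d-\boldsymbol e_k)=0$ if $d_k=0$. -/

import Mathlib

open MeasureTheory ProbabilityTheory Filter Topology

/-- A finite loopless multigraph on the vertex set `V` whose edges have one of `N` types:
`mult k e` is the number of edges of type `k` joining the two endpoints of `e`. -/
structure TypedMultigraph (N : ℕ) (V : Type*) where
  mult : Fin N → Sym2 V → ℕ
  loopless : ∀ k v, mult k s(v, v) = 0

namespace TypedMultigraph

variable {N : ℕ} {V : Type*}

/-- There are only countably many such graphs on a finite vertex set, so random graphs are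
considered with respect to the discrete `σ`-algebra. -/
instance : MeasurableSpace (TypedMultigraph N V) := ⊤

/-- The number `|E^(k)|` of edges of type `k`. -/
def edgeCount [Fintype V] [DecidableEq V] (G : TypedMultigraph N V) (k : Fin N) : ℕ :=
  ∑ e : Sym2 V, G.mult k e

/-- The total number `|E|` of edges. -/
def totalEdgeCount [Fintype V] [DecidableEq V] (G : TypedMultigraph N V) : ℕ :=
  ∑ k, G.edgeCount k

/-- The generalized degree of `v`: its `k`-th coordinate is the number of edges of type `k`
connected to `v` (there are no loops). -/
def deg [Fintype V] (G : TypedMultigraph N V) (v : V) : Fin N → ℕ :=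
  fun k => ∑ w : V, G.mult k s(v, w)

/-- The number `X(d)` of vertices with generalized degree `d`. -/
def degreeCount [Fintype V] (G : TypedMultigraph N V) (d : Fin N → ℕ) : ℕ :=
  (Finset.univ.filter fun v => G.deg v = d).card

/-- The proportion `|E^(k)| / |E|` of the edges of type `k`. -/
noncomputable def edgeProportion [Fintype V] [DecidableEq V] (G : TypedMultigraph N V)
    (k : Fin N) : ℝ :=
  (G.edgeCount k : ℝ) / (G.totalEdgeCount : ℝ)

end TypedMultigraph

section Model

variable {Ω : Type*} {N s : ℕ}

/-- `𝓕_n`, the `σ`-algebra generated by the first `n` graphs `G_1, …, G_n`; it is trivial for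
`n = 0`. -/
abbrev graphHistory (G : (n : ℕ) → Ω → TypedMultigraph N (Fin (s + n))) (n : ℕ) :
    MeasurableSpace Ω :=
  ⨆ i ∈ Set.Icc 1 n, MeasurableSpace.comap (G i) inferInstance

/-- `𝓕_n^+ = σ(𝓕_n, lam_{n+1})`. -/
abbrev graphHistoryPlus (G : (n : ℕ) → Ω → TypedMultigraph N (Fin (s + n))) (lam : ℕ → Ω → ℝ)
    (n : ℕ) : MeasurableSpace Ω :=
  graphHistory G n ⊔ MeasurableSpace.comap (lam (n + 1)) inferInstance

/-- The number of edges of type `k` between the new vertex of step `n + 1`, which is the last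
element of `Fin (s + (n + 1))`, and the old vertex `w`. -/
def newEdges (G : (n : ℕ) → Ω → TypedMultigraph N (Fin (s + n))) (n : ℕ) (k : Fin N)
    (w : Fin (s + n)) (ω : Ω) : ℕ :=
  (G (n + 1) ω).mult k s(w.castSucc, Fin.last (s + n))

/-- The Poisson parameter `lam_{n+1} deg_n^(k)(w) / (2 |E_n|)`. -/
noncomputable def attachmentRate (G : (n : ℕ) → Ω → TypedMultigraph N (Fin (s + n)))
    (lam : ℕ → Ω → ℝ) (n : ℕ) (k : Fin N) (w : Fin (s + n)) (ω : Ω) : ℝ :=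
  lam (n + 1) ω * (((G n ω).deg w k : ℝ) / (2 * ((G n ω).totalEdgeCount : ℝ)))

/-- The model of independent edges started from the deterministic graph `g₀` on `s` vertices.
In step `n + 1` one vertex is added to the `s + n` vertices of `G n` (which are embedded by
`Fin.castSucc`), old edges are kept, every new edge joins the new vertex to an old one, and
conditionally on `𝓕_n^+` the numbers of new edges of type `k` to the old vertex `w` are
independent (over all `k` and `w`) Poisson variables with parameters `attachmentRate`.
Only `lam 1, lam 2, …` are used. -/
structure IsIndependentEdgesModel [MeasurableSpace Ω] (P : Measure Ω)
    (g₀ : TypedMultigraph N (Fin s)) (lam : ℕ → Ω → ℝ)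
    (G : (n : ℕ) → Ω → TypedMultigraph N (Fin (s + n))) : Prop where
  measurable_graph : ∀ n, Measurable (G n)
  initial : ∀ ω, G 0 ω = g₀
  old_edges : ∀ n ω k (u v : Fin (s + n)),
    (G (n + 1) ω).mult k s(u.castSucc, v.castSucc) = (G n ω).mult k s(u, v)
  new_edges : ∀ n (a : Fin N → Fin (s + n) → ℕ),
    P[Set.indicator {ω | ∀ k w, newEdges G n k w ω = a k w} (fun _ => (1 : ℝ))
        | graphHistoryPlus G lam n] =ᵐ[P]
      fun ω => ∏ k, ∏ w, (poissonMeasure (attachmentRate G lam n k w ω).toNNReal).real {a k w}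

/-- (IE1): every `lam_n`, `n ≥ 1`, is a positive random variable independent of `𝓕_{n-1}`. -/
structure AssumptionIE1 [MeasurableSpace Ω] (P : Measure Ω) (lam : ℕ → Ω → ℝ)
    (G : (n : ℕ) → Ω → TypedMultigraph N (Fin (s + n))) : Prop where
  measurable : ∀ n, Measurable (lam (n + 1))
  pos : ∀ n, ∀ᵐ ω ∂P, 0 < lam (n + 1) ω
  indep : ∀ n, Indep (MeasurableSpace.comap (lam (n + 1)) inferInstance) (graphHistory G n) P

/-- (IE2) with the limit variable `L`: `L` is positive, `lam_n → L` in distribution, and for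
every `p ≥ 1` the `p`-th moments (as elements of `[0, ∞]`) converge to that of `L`, which is
finite. -/
structure AssumptionIE2 {Ω' : Type*} [MeasurableSpace Ω] [MeasurableSpace Ω']
    (P : Measure Ω) [IsProbabilityMeasure P] (P' : Measure Ω') [IsProbabilityMeasure P']
    (lam : ℕ → Ω → ℝ) (L : Ω' → ℝ) : Prop where
  pos : ∀ᵐ ω ∂P', 0 < L ω
  tendsto_distribution :
    TendstoInDistribution (fun n => lam (n + 1)) atTop L (fun _ => P) P'
  moment_lt_top : ∀ p : ℕ, 1 ≤ p → ∫⁻ ω, ENNReal.ofReal (L ω ^ p) ∂P' < ⊤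
  tendsto_moment : ∀ p : ℕ, 1 ≤ p →
    Tendsto (fun n => ∫⁻ ω, ENNReal.ofReal (lam (n + 1) ω ^ p) ∂P) atTop
      (𝓝 (∫⁻ ω, ENNReal.ofReal (L ω ^ p) ∂P'))

end Model

/-! Each step of the model is a drift plus noise. Since `lam (n + 1)` is independent of the past,
averaging over it shows that, given the past, the array of new edges has a law depending on the
present graph only: a mixture of independent Poisson arrays (`measure_inter_newEdgeArray_eq`).
Functionals growing at most linearly in the number of new edges have eventually bounded second
moments, so their deviations from the conditional means average out to zero almost surely
(`ae_tendsto_average_sub_integral`).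

Edges: a step adds on average as many edges as the mean of `lam (n + 1)`, so |E_n| grows like μn
with μ > 0 the mean of the limit `L`. By the size-bias identity for Poisson arrays, type k receives
in mean its current share of the new edges even after weighting by a function of their total number.
Hence the proportion of type k is a bounded martingale and converges.

Degrees: write D for the total of d. A vertex of degree d leaves its class at a rate close to
D/(2n), and a vertex of degree d - e_k enters at a rate close to (d_k - 1)/(2n), since the mean of
`lam (n + 1)` cancels against μ. Double hits matter only at vertices of total degree at most D, so
they cost O(1/n) per step. By superposition the type degrees of the new vertex are, given the step
parameter, independent Poisson variables, which yields the factor with the mean of L^D exp(-L). Thus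
X_n(d) satisfies X_{n+1} = X_n - (D/2 + o(1)) X_n/n + b_n + noise with b_n → β, which forces X_n/n →
β/(1 + D/2) (`tendsto_div_of_recursion`). This is the stated recursion, and induction on D gives
existence of all limits. -/

/-! ### Independent Poisson arrays and size biasing. -/

open scoped NNReal ENNReal in
theorem natCast_mul_prod_poissonMeasure {κ : Type*} [Fintype κ] [DecidableEq κ] (R : κ → ℝ≥0)
    (d : κ → ℕ) (j : κ) :
    ((d j + 1 : ℕ) : ℝ≥0∞) * ∏ k, poissonMeasure (R k) {(d + Pi.single j 1 : κ → ℕ) k} =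
      R j * ∏ k, poissonMeasure (R k) {d k} := by
  rw [← Finset.mul_prod_erase _ _ (Finset.mem_univ j),
    ← Finset.mul_prod_erase Finset.univ (fun k => poissonMeasure (R k) {d k})
      (Finset.mem_univ j), ← mul_assoc, ← mul_assoc]
  congr 1
  · simp only [Pi.add_apply, Pi.single_eq_same, poissonMeasure_singleton]
    rw [← ENNReal.ofReal_coe_nnreal (p := R j), ← ENNReal.ofReal_natCast,
      ← ENNReal.ofReal_mul (by positivity), ← ENNReal.ofReal_mul (by positivity)]
    congr 1
    rw [Nat.factorial_succ]
    push_cast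
    field_simp
    ring
  · refine Finset.prod_congr rfl fun k hk => ?_
    simp [Pi.single_eq_of_ne (Finset.ne_of_mem_erase hk)]

open scoped NNReal ENNReal in
-- The size-bias (Mecke) identity: terms with a_i = 0 vanish, the others are reindexed by the shift
-- by one unit at i, and the ratio of neighbouring Poisson weights trades the factor a_i + 1 for
-- r_i. Factorial moments, superposition and the martingale property of the edge proportions all
-- come from it.
theorem lintegral_poisson_coord_mul {ι : Type*} [Fintype ι] [DecidableEq ι] (r : ι → ℝ≥0) (i : ι)
    (F : (ι → ℕ) → ℝ≥0∞) :
    ∫⁻ a, (a i : ℝ≥0∞) * F a ∂(Measure.pi fun i => poissonMeasure (r i)) =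
      r i * ∫⁻ a, F (a + Pi.single i 1) ∂(Measure.pi fun i => poissonMeasure (r i)) := by
  rw [lintegral_countable', lintegral_countable', ← ENNReal.tsum_mul_left]
  have hinj : Function.Injective (fun a : ι → ℕ => a + Pi.single i 1) :=
    add_left_injective _
  rw [← hinj.tsum_eq]
  · refine tsum_congr fun a => ?_
    simp only [Measure.pi_singleton]
    have key := natCast_mul_prod_poissonMeasure r a i
    simp only [Pi.add_apply, Pi.single_eq_same] at key ⊢
    rw [mul_right_comm, key]
    ring
  · intro a ha
    have h0 : a i ≠ 0 := by
      rintro h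
      simp [h] at ha
    refine ⟨a - Pi.single i 1, funext fun j => ?_⟩
    by_cases hj : j = i
    · subst hj; simp; omega
    · simp [Pi.single_eq_of_ne hj]

section Total

open scoped NNReal ENNReal

variable {ι : Type*} [Fintype ι] [DecidableEq ι] (r : ι → ℝ≥0)

theorem lintegral_poisson_sum_mul (S : Finset ι) (F : (ι → ℕ) → ℝ≥0∞) :
    ∫⁻ a, ((∑ i ∈ S, a i : ℕ) : ℝ≥0∞) * F a ∂(Measure.pi fun i => poissonMeasure (r i)) =
      ∑ i ∈ S, r i * ∫⁻ a, F (a + Pi.single i 1) ∂(Measure.pi fun i => poissonMeasure (r i)) := by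
  simp_rw [← lintegral_poisson_coord_mul, Nat.cast_sum, Finset.sum_mul]
  exact lintegral_finsetSum _ fun i _ => measurable_of_countable _

theorem lintegral_poisson_sum (S : Finset ι) :
    ∫⁻ a, ((∑ i ∈ S, a i : ℕ) : ℝ≥0∞) ∂(Measure.pi fun i => poissonMeasure (r i)) =
      ∑ i ∈ S, (r i : ℝ≥0∞) := by
  simpa using lintegral_poisson_sum_mul r S fun _ => 1

/-- With T the sum over S, size biasing adds one unit to T and turns T - 1 into T. Truncated
subtraction is harmless because the factor T vanishes at T = 0. -/
theorem lintegral_poisson_sum_mul_pred (S : Finset ι) :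
    ∫⁻ a, (((∑ i ∈ S, a i) * ((∑ i ∈ S, a i) - 1) : ℕ) : ℝ≥0∞)
        ∂(Measure.pi fun i => poissonMeasure (r i)) =
      (∑ i ∈ S, (r i : ℝ≥0∞)) ^ 2 := by
  have h := lintegral_poisson_sum_mul r S fun a => ((∑ i ∈ S, a i - 1 : ℕ) : ℝ≥0∞)
  simp_rw [Nat.cast_mul]
  rw [h, sq, Finset.sum_mul]
  refine Finset.sum_congr rfl fun i hi => ?_
  rw [← lintegral_poisson_sum]
  congr 2 with a
  have : ∑ j ∈ S, (a + Pi.single i 1 : ι → ℕ) j = ∑ j ∈ S, a j + 1 := by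
    simp [Finset.sum_add_distrib, Pi.single_apply, hi]
  rw [this, Nat.add_sub_cancel]

end Total

open scoped NNReal ENNReal in
/-- The row sums of an array of independent Poisson variables are independent Poisson variables. -/
theorem poisson_rowSum_eq {κ W : Type*} [Fintype κ] [DecidableEq κ] [Fintype W] [DecidableEq W]
    (r : κ × W → ℝ≥0) (d : κ → ℕ) :
    (Measure.pi fun i => poissonMeasure (r i)) {a | (fun k => ∑ w, a (k, w)) = d} =
      ∏ k, poissonMeasure (∑ w, r (k, w)) {d k} := by
  -- Both sides satisfy the same recursion from d' to d' + e_j, and they agree at d = 0; hence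
  -- induction on the total of d.
  induction h : ∑ k, d k generalizing d with
  | zero =>
    have hd : d = 0 := by
      funext k
      exact (Finset.sum_eq_zero_iff.1 h) k (Finset.mem_univ k)
    have hs : {a : κ × W → ℕ | (fun k => ∑ w, a (k, w)) = d} = {0} := by
      ext a
      simp [hd, funext_iff, Prod.forall]
    rw [hs, Measure.pi_singleton, Fintype.prod_prod_type]
    refine Finset.prod_congr rfl fun k _ => ?_
    simp only [poissonMeasure_singleton, hd, Pi.zero_apply]
    rw [← ENNReal.ofReal_prod_of_nonneg fun _ _ => by positivity]
    congr 1
    simp [← Real.exp_sum]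
  | succ n ih =>
    obtain ⟨j, hj⟩ : ∃ j, d j ≠ 0 := by
      by_contra! hc
      simp [hc] at h
    obtain ⟨d', rfl⟩ : ∃ d', d = d' + Pi.single j 1 :=
      ⟨d - Pi.single j 1, funext fun k => by
        by_cases hk : k = j
        · subst hk; simp; omega
        · simp [Pi.single_eq_of_ne hk]⟩
    have h' : ∑ k, d' k = n := by
      simp [Finset.sum_add_distrib, Pi.single_apply] at h
      exact h
    have hne : ((d' j + 1 : ℕ) : ℝ≥0∞) ≠ 0 := by simp
    rw [← ENNReal.mul_right_inj hne (ENNReal.natCast_ne_top _), natCast_mul_prod_poissonMeasure,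
      ← ih d' h']
    set μ := Measure.pi fun i => poissonMeasure (r i)
    have hS : ∀ a : κ × W → ℕ, ∑ i ∈ Finset.univ.map (Function.Embedding.sectR j W), a i = ∑ w, a (j, w) := by
      intro a; simp
    have key := lintegral_poisson_sum_mul r (Finset.univ.map (Function.Embedding.sectR j W))
        (Set.indicator {a : κ × W → ℕ | (fun k => ∑ w, a (k, w)) = d' + Pi.single j 1} 1)
    simp_rw [hS] at key
    -- On the event the sum of row j equals d'_j + 1, so the size-biasing factor is constant there.
    have e1 : ∀ a : κ × W → ℕ, ((∑ w, a (j, w) : ℕ) : ℝ≥0∞) *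
        Set.indicator {a : κ × W → ℕ | (fun k => ∑ w, a (k, w)) = d' + Pi.single j 1} 1 a =
        ((d' j + 1 : ℕ) : ℝ≥0∞) *
        Set.indicator {a : κ × W → ℕ | (fun k => ∑ w, a (k, w)) = d' + Pi.single j 1} 1 a := by
      intro a
      by_cases ha : (fun k => ∑ w, a (k, w)) = d' + Pi.single j 1
      · have := congrFun ha j
        simp only [Pi.add_apply, Pi.single_eq_same] at this
        rw [this]
      · simp [ha]
    simp_rw [e1] at key
    rw [lintegral_const_mul _ (measurable_of_countable _),
      lintegral_indicator_one (Set.to_countable _).measurableSet] at key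
    rw [key, Finset.sum_map, ENNReal.ofNNReal_finsetSum, Finset.sum_mul]
    refine Finset.sum_congr rfl fun w _ => ?_
    congr 1
    rw [← lintegral_indicator_one (Set.to_countable _).measurableSet]
    refine lintegral_congr fun a => ?_
    simp only [Set.indicator_apply, Set.mem_ofPred_eq, Function.Embedding.sectR_apply]
    have : (fun k => ∑ w', (a + Pi.single (j, w) 1 : κ × W → ℕ) (k, w')) =
        (fun k => ∑ w', a (k, w')) + Pi.single j 1 := by
      funext k
      by_cases hk : k = j
      · subst hk
        simp [Finset.sum_add_distrib, Pi.single_apply, Prod.ext_iff]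
      · simp [Prod.ext_iff, hk]
    simp only [this, add_left_inj, Pi.one_apply]

/-! ### Deterministic limits: Kronecker's lemma and linear recursions. -/

/-- Kronecker's lemma with weights i + 1: summation by parts writes the average as the weighted
partial sum minus its own Cesàro mean, and both have the limit c. -/
theorem tendsto_average_of_tendsto_sum_div {D : ℕ → ℝ} {c : ℝ}
    (h : Tendsto (fun n => ∑ i ∈ Finset.range n, D i / (i + 1)) atTop (𝓝 c)) :
    Tendsto (fun n : ℕ => (n : ℝ)⁻¹ * ∑ i ∈ Finset.range n, D i) atTop (𝓝 0) := by
  set U : ℕ → ℝ := fun n => ∑ i ∈ Finset.range n, D i / (i + 1) with hU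
  have h1 : ∀ n : ℕ, ∑ i ∈ Finset.range n, D i = n * U n - ∑ i ∈ Finset.range n, U i := by
    intro n
    induction n with
    | zero => simp
    | succ n ih =>
      have : U (n + 1) = U n + D n / (n + 1) := Finset.sum_range_succ _ _
      rw [Finset.sum_range_succ, ih, Finset.sum_range_succ, this]
      have : (n : ℝ) + 1 ≠ 0 := by positivity
      push_cast
      field_simp
      ring
  have h2 := h.sub h.cesaro
  rw [sub_self] at h2
  refine h2.congr' ?_
  filter_upwards [eventually_gt_atTop 0] with n hn
  have : (n : ℝ) ≠ 0 := by positivity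
  rw [h1, mul_sub, inv_mul_cancel_left₀ this]

/-- After removing the accumulated noise and the expected linear growth from Y, the remainder w
obeys a recursion whose multiplier eventually lies in [0, 1] and whose source tends to 0, so w grows
sublinearly. -/
theorem tendsto_div_of_recursion {s : ℕ} {Y a b D : ℕ → ℝ} {α β : ℝ} (hα : 0 ≤ α)
    (hs : 0 < s) (ha0 : ∀ n, 0 ≤ a n)
    (ha : Tendsto a atTop (𝓝 α)) (hb : Tendsto b atTop (𝓝 β))
    (hD : Tendsto (fun n : ℕ => (n : ℝ)⁻¹ * ∑ i ∈ Finset.range n, D i) atTop (𝓝 0))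
    (hY : ∀ n, Y (n + 1) = Y n - a n * (Y n / (s + n : ℕ)) + b n + D n) :
    Tendsto (fun n => Y n / (s + n : ℕ)) atTop (𝓝 (β / (1 + α))) := by
  have hα1 : 1 + α ≠ 0 := by positivity
  have ht : ∀ n : ℕ, (0 : ℝ) < (s + n : ℕ) := fun n => by positivity
  have hsmall : ∀ {S : ℕ → ℝ}, Tendsto (fun n : ℕ => (n : ℝ)⁻¹ * S n) atTop (𝓝 0) →
      Tendsto (fun n => S n / (s + n : ℕ)) atTop (𝓝 0) := by
    intro S hS
    refine squeeze_zero_norm' ?_ (by simpa using hS.norm)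
    filter_upwards [eventually_gt_atTop 0] with n hn
    have hn' : (0 : ℝ) < n := by positivity
    rw [norm_div, inv_mul_eq_div, Real.norm_of_nonneg (ht n).le, Real.norm_eq_abs]
    gcongr
    linarith [(Nat.cast_nonneg s : (0:ℝ) ≤ s)]
  set S : ℕ → ℝ := fun n => ∑ i ∈ Finset.range n, D i with hS
  -- The only slope with β - αc - c = 0, which makes the source `ε` below vanish in the limit.
  set c := β / (1 + α) with hc
  set w : ℕ → ℝ := fun n => Y n - S n - (s + n : ℕ) * c with hw
  set ε : ℕ → ℝ := fun n => b n - a n * (S n / (s + n : ℕ)) - a n * c - c with hε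
  have hε0 : Tendsto ε atTop (𝓝 0) := by
    have h := ((hb.sub (ha.mul (hsmall hD))).sub (ha.mul_const c)).sub_const c
    convert h using 2
    rw [hc]
    field_simp
    ring
  have hrec : ∀ n, w (n + 1) = w n * (1 - a n / (s + n : ℕ)) + ε n := by
    intro n
    have h1 : S (n + 1) = S n + D n := Finset.sum_range_succ _ _
    have h2 := (ht n).ne'
    simp only [hw, hε, hY, h1]
    have h3 : ((s + (n + 1) : ℕ) : ℝ) = (s + n : ℕ) + 1 := by push_cast; ring
    rw [h3]
    field_simp
    ring
  have htop : Tendsto (fun n : ℕ => ((s + n : ℕ) : ℝ)) atTop atTop :=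
    tendsto_natCast_atTop_atTop.comp (tendsto_atTop_mono (fun n => Nat.le_add_left n s) tendsto_id)
  obtain ⟨n₀, hn₀⟩ : ∃ n₀, ∀ n ≥ n₀, a n ≤ (s + n : ℕ) := by
    have h1 := ha.eventually (gt_mem_nhds (lt_add_one α))
    obtain ⟨n₀, h⟩ := eventually_atTop.1 (h1.and (htop.eventually_ge_atTop (α + 1)))
    exact ⟨n₀, fun n hn => (h n hn).1.le.trans (h n hn).2⟩
  have hbound : ∀ n, n₀ ≤ n → |w n| ≤ |w n₀| + ∑ i ∈ Finset.range n, |ε i| := by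
    intro n hn
    induction n, hn using Nat.le_induction with
    | base => exact le_add_of_nonneg_right (Finset.sum_nonneg fun _ _ => abs_nonneg _)
    | succ n hn ih =>
      rw [hrec, Finset.sum_range_succ, ← add_assoc]
      refine (abs_add_le _ _).trans (add_le_add_left (le_trans ?_ ih) _)
      rw [abs_mul]
      refine mul_le_of_le_one_right (abs_nonneg _) (abs_le.2 ?_)
      have h1 : 0 ≤ a n / (s + n : ℕ) := div_nonneg (ha0 n) (ht n).le
      have h2 : a n / (s + n : ℕ) ≤ 1 := div_le_one_of_le₀ (hn₀ n hn) (ht n).le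
      constructor <;> linarith
  have hw0 : Tendsto (fun n => w n / (s + n : ℕ)) atTop (𝓝 0) := by
    have h1 : Tendsto (fun n => |w n₀| / (s + n : ℕ) +
        (∑ i ∈ Finset.range n, |ε i|) / (s + n : ℕ)) atTop (𝓝 (0 + 0)) := by
      refine (tendsto_const_nhds.div_atTop htop).add (hsmall ?_)
      have := (hε0.abs).cesaro
      simpa using this
    rw [add_zero] at h1
    refine squeeze_zero_norm' ?_ h1
    filter_upwards [eventually_ge_atTop n₀] with n hn
    rw [norm_div, Real.norm_of_nonneg (ht n).le, ← add_div]
    exact div_le_div_of_nonneg_right (hbound n hn) (ht n).le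
  have := (hw0.add (hsmall hD)).add_const c
  rw [add_zero, zero_add] at this
  refine this.congr fun n => ?_
  have h2 := (ht n).ne'
  simp only [hw]
  field_simp
  ring

/-! ### A strong law for martingale differences. -/

section Martingale

variable {Ω : Type*} {m0 : MeasurableSpace Ω} {P : Measure Ω} [IsProbabilityMeasure P]

/-- Strong law of large numbers for `L²`-bounded martingale differences. -/
theorem ae_tendsto_average_of_condExp_eq_zero (ℱ : Filtration ℕ m0) {D : ℕ → Ω → ℝ}
    (hD : ∀ n, StronglyMeasurable[ℱ (n + 1)] (D n)) (hL2 : ∀ n, MemLp (D n) 2 P) {C : ℝ}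
    (hC : ∀ n, ∫ ω, D n ω ^ 2 ∂P ≤ C) (h0 : ∀ n, P[D n | ℱ n] =ᵐ[P] 0) :
    ∀ᵐ ω ∂P, Tendsto (fun n : ℕ => (n : ℝ)⁻¹ * ∑ i ∈ Finset.range n, D i ω) atTop (𝓝 0) := by
  have hC0 : 0 ≤ C := (integral_nonneg fun _ => sq_nonneg _).trans (hC 0)
  -- The increments D_n/(n + 1) are orthogonal and their variances are summable, so M is bounded in
  -- L², converges almost surely, and Kronecker's lemma applies.
  set M : ℕ → Ω → ℝ := fun n ω => ∑ i ∈ Finset.range n, D i ω / (i + 1) with hM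
  have hMs : ∀ n, M (n + 1) = M n + fun ω => D n ω / (n + 1) := fun n => by
    funext ω; exact Finset.sum_range_succ _ _
  have hMm : ∀ n, StronglyMeasurable[ℱ n] (M n) := fun n =>
    Finset.stronglyMeasurable_fun_sum _ fun i hi =>
      ((hD i).mono (ℱ.mono (Finset.mem_range.1 hi))).measurable.div_const _ |>.stronglyMeasurable
  have hML : ∀ n, MemLp (M n) 2 P := fun n =>
    memLp_finsetSum _ fun i _ => by simpa [div_eq_mul_inv] using (hL2 i).mul_const _
  have hMD : ∀ n, ∫ ω, M n ω * D n ω ∂P = 0 := by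
    intro n
    have h1 : Integrable (M n * D n) P := (hML n).integrable_mul (hL2 n)
    have h2 := condExp_mul_of_stronglyMeasurable_left (hMm n) h1 ((hL2 n).integrable (by norm_num))
    calc ∫ ω, M n ω * D n ω ∂P = ∫ ω, (P[M n * D n | ℱ n]) ω ∂P :=
          (integral_condExp (ℱ.le n)).symm
      _ = ∫ ω, (0 : ℝ) ∂P := integral_congr_ae (by
          filter_upwards [h2, h0 n] with ω h3 h4
          rw [h3, Pi.mul_apply, h4]; simp)
      _ = 0 := by simp
  have hsq : ∀ n, ∫ ω, M n ω ^ 2 ∂P ≤ C * ∑ i ∈ Finset.range n, 1 / ((i : ℝ) + 1) ^ 2 := by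
    intro n
    induction n with
    | zero => simp [hM]
    | succ n ih =>
      have e : ∀ ω, M (n + 1) ω ^ 2 =
          M n ω ^ 2 + (2 / ((n : ℝ) + 1)) * (M n ω * D n ω) +
            (1 / ((n : ℝ) + 1) ^ 2) * D n ω ^ 2 := by
        intro ω
        rw [hMs]
        have : (n : ℝ) + 1 ≠ 0 := by positivity
        simp only [Pi.add_apply]
        field_simp
        ring
      simp_rw [e]
      have i1 : Integrable (fun ω => M n ω ^ 2) P := (hML n).integrable_sq
      have i2 : Integrable (fun ω => (2 / ((n : ℝ) + 1)) * (M n ω * D n ω)) P :=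
        ((hML n).integrable_mul (hL2 n)).const_mul _
      have i3 : Integrable (fun ω => (1 / ((n : ℝ) + 1) ^ 2) * D n ω ^ 2) P :=
        (hL2 n).integrable_sq.const_mul _
      rw [integral_add (f := fun ω => M n ω ^ 2 + (2 / ((n : ℝ) + 1)) * (M n ω * D n ω))
        (i1.add i2) i3, integral_add i1 i2, integral_const_mul, integral_const_mul,
        hMD, Finset.sum_range_succ, mul_add, mul_zero, add_zero, mul_comm C (1 / _)]
      gcongr
      exact hC n
  have hsum : Summable fun i : ℕ => 1 / ((i : ℝ) + 1) ^ 2 := by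
    have := (summable_nat_add_iff 1).2 (Real.summable_one_div_nat_pow (p := 2).2 (by norm_num))
    simpa using this
  set R : ℝ := 1 + C * ∑' i : ℕ, 1 / ((i : ℝ) + 1) ^ 2 with hR
  have hbd : ∀ n, eLpNorm (M n) 1 P ≤ (R.toNNReal : ENNReal) := by
    intro n
    have i1 : Integrable (M n) P := (hML n).integrable (by norm_num)
    rw [eLpNorm_one_eq_lintegral_enorm, ← ofReal_integral_norm_eq_lintegral_enorm i1]
    refine ENNReal.ofReal_le_ofReal ?_
    calc ∫ ω, ‖M n ω‖ ∂P ≤ ∫ ω, (1 + M n ω ^ 2) ∂P := by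
          refine integral_mono i1.norm ((integrable_const 1).add (hML n).integrable_sq) fun ω => ?_
          simp only [Real.norm_eq_abs]
          nlinarith [sq_nonneg (|M n ω| - 1), sq_abs (M n ω)]
      _ = 1 + ∫ ω, M n ω ^ 2 ∂P := by
          rw [integral_add (integrable_const 1) (hML n).integrable_sq]; simp
      _ ≤ R := by
          rw [hR]
          gcongr
          refine (hsq n).trans ?_
          gcongr
          exact hsum.sum_le_tsum _ fun i _ => by positivity
  have hmart : Martingale M ℱ P := by
    refine martingale_nat hMm (fun n => (hML n).integrable (by norm_num)) fun n => ?_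
    have i1 : Integrable (M n) P := (hML n).integrable (by norm_num)
    have i2 : Integrable (D n) P := (hL2 n).integrable (by norm_num)
    have e : (fun ω => D n ω / ((n : ℝ) + 1)) = ((n : ℝ) + 1)⁻¹ • D n := by
      funext ω; simp [div_eq_inv_mul]
    rw [hMs, e]
    filter_upwards [condExp_add i1 (i2.smul ((n : ℝ) + 1)⁻¹) (ℱ n), h0 n,
      condExp_smul ((n : ℝ) + 1)⁻¹ (D n) (ℱ n) (μ := P)] with ω h1 h2 h3
    rw [h1, Pi.add_apply, h3, Pi.smul_apply, h2,
      condExp_of_stronglyMeasurable (ℱ.le n) (hMm n) i1]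
    simp
  filter_upwards [hmart.submartingale.exists_ae_tendsto_of_bdd hbd] with ω ⟨c, hc⟩
  exact tendsto_average_of_tendsto_sum_div hc

end Martingale

/-! ### Conditional laws given by a kernel on countable spaces. -/

section Markov

variable {Ω γ A : Type*} {m m0 : MeasurableSpace Ω} {P : Measure Ω} [IsProbabilityMeasure P]
  [MeasurableSpace γ] [Countable γ] [MeasurableSingletonClass γ]
  [MeasurableSpace A] [Countable A] [MeasurableSingletonClass A]
  {H : Ω → γ} {Y : Ω → A} {κ : Kernel γ A} [IsMarkovKernel κ]

/-- Countability reduces the identity of laws to atoms. Restricting to an event B is what later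
yields set integrals over every event of the past. -/
theorem map_restrict_eq_compProd (hH : Measurable H) (hY : Measurable Y) {B : Set Ω}
    (hB : ∀ g a, P (B ∩ H ⁻¹' {g} ∩ Y ⁻¹' {a}) = P (B ∩ H ⁻¹' {g}) * κ g {a}) :
    (P.restrict B).map (fun ω => (H ω, Y ω)) = (P.restrict B).map H ⊗ₘ κ := by
  refine Measure.ext_of_singleton fun ⟨g, a⟩ => ?_
  rw [← Set.singleton_prod_singleton, Measure.compProd_apply_prod (measurableSet_singleton g)
    (measurableSet_singleton a), lintegral_singleton,
    Measure.map_apply (hH.prodMk hY) ((measurableSet_singleton g).prod (measurableSet_singleton a)),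
    Measure.map_apply hH (measurableSet_singleton g),
    Measure.restrict_apply (hH (measurableSet_singleton g)),
    Measure.restrict_apply ((hH.prodMk hY)
      ((measurableSet_singleton g).prod (measurableSet_singleton a))), Set.mk_preimage_prod,
    mul_comm, Set.inter_comm _ B, Set.inter_comm _ B, ← hB, Set.inter_assoc]

theorem lintegral_eq_lintegral_kernel (hm : m ≤ m0) (hH : Measurable[m] H)
    (hY : Measurable Y) (hB : ∀ B, MeasurableSet[m] B → ∀ g a,
      P (B ∩ H ⁻¹' {g} ∩ Y ⁻¹' {a}) = P (B ∩ H ⁻¹' {g}) * κ g {a})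
    (F : γ → A → ENNReal) :
    ∫⁻ ω, F (H ω) (Y ω) ∂P = ∫⁻ ω, ∫⁻ a, F (H ω) a ∂(κ (H ω)) ∂P := by
  have hH' : Measurable H := hH.mono hm le_rfl
  have h := map_restrict_eq_compProd hH' hY (hB Set.univ MeasurableSet.univ)
  rw [Measure.restrict_univ] at h
  have h1 : ∫⁻ p, F p.1 p.2 ∂(P.map fun ω => (H ω, Y ω)) = ∫⁻ p, F p.1 p.2 ∂(P.map H ⊗ₘ κ) := by
    rw [h]
  rwa [lintegral_map (measurable_of_countable _) (hH'.prodMk hY),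
    Measure.lintegral_compProd (measurable_of_countable _),
    lintegral_map (measurable_of_countable _) hH'] at h1

theorem condExp_eq_integral_kernel (hm : m ≤ m0) (hH : Measurable[m] H)
    (hY : Measurable Y) (hB : ∀ B, MeasurableSet[m] B → ∀ g a,
      P (B ∩ H ⁻¹' {g} ∩ Y ⁻¹' {a}) = P (B ∩ H ⁻¹' {g}) * κ g {a})
    (F : γ → A → ℝ) (hF : Integrable (fun ω => F (H ω) (Y ω)) P) :
    P[fun ω => F (H ω) (Y ω) | m] =ᵐ[P] fun ω => ∫ a, F (H ω) a ∂(κ (H ω)) := by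
  have hH' : Measurable H := hH.mono hm le_rfl
  have hpair := hH'.prodMk hY
  have hint : ∀ B, MeasurableSet[m] B →
      Integrable (fun p : γ × A => F p.1 p.2) ((P.restrict B).map H ⊗ₘ κ) := by
    intro B hBm
    rw [← map_restrict_eq_compProd hH' hY (hB B hBm),
      integrable_map_measure (measurable_of_countable _).aestronglyMeasurable hpair.aemeasurable]
    exact hF.restrict
  have hint2 : ∀ B, MeasurableSet[m] B →
      IntegrableOn (fun ω => ∫ a, F (H ω) a ∂(κ (H ω))) B P := by
    intro B hBm
    have h := ((Measure.integrable_compProd_iff (hint B hBm).aestronglyMeasurable).1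
      (hint B hBm)).2
    rw [integrable_map_measure (measurable_of_countable _).aestronglyMeasurable
      hH'.aemeasurable] at h
    have hK : Measurable fun g => ∫ a, F g a ∂(κ g) := measurable_of_countable _
    exact h.mono' (hK.comp hH').aestronglyMeasurable
      (Eventually.of_forall fun ω => norm_integral_le_integral_norm _)
  refine (ae_eq_condExp_of_forall_setIntegral_eq hm hF (fun B hBm _ => hint2 B hBm)
    (fun B hBm _ => ?_) ?_).symm
  · have h1 : ∫ p, F p.1 p.2 ∂((P.restrict B).map fun ω => (H ω, Y ω)) =
        ∫ p, F p.1 p.2 ∂((P.restrict B).map H ⊗ₘ κ) := by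
      rw [map_restrict_eq_compProd hH' hY (hB B hBm)]
    rw [integral_map hpair.aemeasurable (measurable_of_countable _).aestronglyMeasurable,
      Measure.integral_compProd (hint B hBm),
      integral_map hH'.aemeasurable (measurable_of_countable _).aestronglyMeasurable] at h1
    exact h1.symm
  · have h : Measurable fun g => ∫ a, F g a ∂(κ g) := measurable_of_countable _
    exact (h.comp hH).stronglyMeasurable.aestronglyMeasurable

end Markov

/-! ### Combinatorics of adding one vertex. -/

namespace TypedMultigraph

section Basic

variable {N : ℕ} {V : Type*}

/-- Countability makes every functional of the graph and of the edge array measurable and lets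
conditional laws be checked on atoms. -/
instance [Finite V] : Countable (TypedMultigraph N V) := by
  have h : Function.Injective (TypedMultigraph.mult : TypedMultigraph N V → _) := by
    rintro ⟨a, _⟩ ⟨b, _⟩ h
    congr
  exact h.countable

instance : DiscreteMeasurableSpace (TypedMultigraph N V) := ⟨fun _ => trivial⟩

/-- The handshake identity. -/
theorem sum_deg_eq_two_mul_edgeCount [Fintype V] [DecidableEq V] (G : TypedMultigraph N V)
    (k : Fin N) : ∑ v, G.deg v k = 2 * G.edgeCount k := by
  simp only [deg, edgeCount]
  rw [← Fintype.sum_prod_type' (f := fun v w => G.mult k s(v, w)),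
    ← Finset.sum_fiberwise (s := Finset.univ) (g := fun p : V × V => s(p.1, p.2)),
    Finset.mul_sum]
  refine Finset.sum_congr rfl fun e _ => ?_
  induction e with | _ x y => ?_
  rw [Finset.sum_congr rfl (g := fun _ => G.mult k s(x, y))
    fun p hp => by rw [(Finset.mem_filter.1 hp).2], Finset.sum_const, smul_eq_mul]
  by_cases hxy : x = y
  · subst hxy
    simp [G.loopless]
  · congr 1
    have : (Finset.univ.filter fun p : V × V => s(p.1, p.2) = s(x, y)) = {(x, y), (y, x)} := by
      ext ⟨u, v⟩
      simp
    rw [this, Finset.card_pair (by simp [hxy])]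

end Basic

section Extension

variable {N m : ℕ} {g : TypedMultigraph N (Fin m)} {G : TypedMultigraph N (Fin (m + 1))}
  (h : ∀ k (u v : Fin m), G.mult k s(u.castSucc, v.castSucc) = g.mult k s(u, v))

include h in
theorem deg_castSucc (w : Fin m) :
    G.deg w.castSucc = g.deg w + fun k => G.mult k s(w.castSucc, Fin.last m) := by
  funext k
  simp [deg, Fin.sum_univ_castSucc, h]

theorem deg_last (G : TypedMultigraph N (Fin (m + 1))) :
    G.deg (Fin.last m) = fun k => ∑ w : Fin m, G.mult k s(w.castSucc, Fin.last m) := by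
  funext k
  simp [deg, Fin.sum_univ_castSucc, G.loopless, Sym2.eq_swap]

include h in
-- The handshake identity for both graphs: a new edge is counted once at its old endpoint and once
-- at the last vertex.
theorem edgeCount_extension (k : Fin N) :
    G.edgeCount k = g.edgeCount k + ∑ w : Fin m, G.mult k s(w.castSucc, Fin.last m) := by
  have h1 := G.sum_deg_eq_two_mul_edgeCount k
  have h2 := g.sum_deg_eq_two_mul_edgeCount k
  rw [Fin.sum_univ_castSucc, deg_last] at h1
  simp_rw [deg_castSucc h, Pi.add_apply] at h1
  rw [Finset.sum_add_distrib, h2] at h1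
  omega

include h in
theorem totalEdgeCount_extension :
    G.totalEdgeCount = g.totalEdgeCount +
      ∑ i : Fin N × Fin m, G.mult i.1 s(i.2.castSucc, Fin.last m) := by
  simp only [totalEdgeCount, edgeCount_extension h, Finset.sum_add_distrib,
    Fintype.sum_prod_type]

include h in
theorem degreeCount_extension (d : Fin N → ℕ) :
    G.degreeCount d =
      ∑ w : Fin m, (if (g.deg w + fun k => G.mult k s(w.castSucc, Fin.last m)) = d then 1 else 0) +
      if (fun k => ∑ w : Fin m, G.mult k s(w.castSucc, Fin.last m)) = d then 1 else 0 := by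
  rw [degreeCount, Finset.card_filter, Fin.sum_univ_castSucc, deg_last]
  simp_rw [deg_castSucc h]

end Extension

end TypedMultigraph

/-- The first-order approximation of the indicator of `d' + c = d` for a small increment `c`. -/
theorem abs_indicator_add_eq_sub_le {N : ℕ} (d d' c : Fin N → ℕ) :
    |(if d' + c = d then (1 : ℝ) else 0) - ((if d' = d then 1 - ((∑ k, c k : ℕ) : ℝ) else 0) +
        ∑ k, if d' + Pi.single k 1 = d then (c k : ℝ) else 0)| ≤
      if ∑ k, d' k ≤ ∑ k, d k then
        (((∑ k, c k) * ((∑ k, c k) - 1) : ℕ) : ℝ) else 0 := by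
  -- Past the cutoff every term vanishes, since increments only raise degrees. The cutoff keeps
  -- vertices of large degree out of the error.
  by_cases hle : ∑ k, d' k ≤ ∑ k, d k
  swap
  · have h1 : d' + c ≠ d := by
      rintro rfl
      exact hle (Finset.sum_le_sum fun k _ => by simp)
    have h2 : d' ≠ d := by
      rintro rfl
      exact hle le_rfl
    have h3 : ∀ k, d' + Pi.single k 1 ≠ d := by
      rintro k rfl
      exact hle (Finset.sum_le_sum fun k _ => by simp)
    simp [h1, h2, h3, hle]
  rw [if_pos hle]
  -- The expansion is exact when at most one edge arrives. With Z ≥ 2 edges the error is at most Z,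
  -- hence at most Z(Z - 1).
  obtain hZ | hZ | hZ : ∑ k, c k = 0 ∨ ∑ k, c k = 1 ∨ 2 ≤ ∑ k, c k := by omega
  · have hc : c = 0 := funext fun k => (Finset.sum_eq_zero_iff.1 hZ) k (Finset.mem_univ k)
    subst hc
    simp
  · obtain ⟨j, hj⟩ : ∃ j, c = Pi.single j 1 := by
      obtain ⟨j, hj⟩ : ∃ j, c j ≠ 0 := by
        by_contra! hc
        simp [hc] at hZ
      have h1 := Finset.add_sum_erase Finset.univ c (Finset.mem_univ j)
      have h2 : ∑ k ∈ Finset.univ.erase j, c k = 0 := by omega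
      refine ⟨j, funext fun k => ?_⟩
      by_cases hk : k = j
      · subst hk
        simp
        omega
      · rw [Pi.single_eq_of_ne hk]
        exact Finset.sum_eq_zero_iff.1 h2 k (Finset.mem_erase.2 ⟨hk, Finset.mem_univ k⟩)
    have h3 : ∑ k, (if d' + Pi.single k 1 = d then (c k : ℝ) else 0) =
        if d' + Pi.single j 1 = d then 1 else 0 := by
      rw [Finset.sum_eq_single j]
      · simp [hj]
      · intro k _ hk
        simp [hj, Pi.single_eq_of_ne hk]
      · simp
    rw [hZ, h3, hj]
    simp
  · have hc : c ≠ 0 := by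
      rintro rfl
      simp at hZ
    set Z := ∑ k, c k with hZdef
    have hZ1 : ((Z * (Z - 1) : ℕ) : ℝ) = Z * (Z - 1) := by
      rw [Nat.cast_mul, Nat.cast_sub (by omega), Nat.cast_one]
    have hZ2 : (2 : ℝ) ≤ Z := by exact_mod_cast hZ
    rw [hZ1]
    by_cases hd : d' = d
    · subst hd
      have h1 : ∀ k : Fin N, d' + Pi.single k 1 ≠ d' := fun k hk => by
        have := congrFun hk k
        simp at this
      rw [if_neg (by simpa using hc), if_pos rfl, Finset.sum_eq_zero fun k _ => if_neg (h1 k),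
        abs_le]
      constructor <;> nlinarith
    · have h0 : 0 ≤ ∑ k, (if d' + Pi.single k 1 = d then (c k : ℝ) else 0) :=
        Finset.sum_nonneg fun k _ => by positivity
      have h1 : ∑ k, (if d' + Pi.single k 1 = d then (c k : ℝ) else 0) ≤ Z := by
        rw [hZdef, Nat.cast_sum]
        refine Finset.sum_le_sum fun k _ => ?_
        split_ifs <;> simp
      rw [if_neg hd, abs_le]
      constructor <;> split_ifs <;> nlinarith

open scoped NNReal ENNReal in
theorem integral_natCast_eq_toReal_lintegral {A : Type*} [MeasurableSpace A] [Countable A]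
    [MeasurableSingletonClass A] (μ : Measure A) (f : A → ℕ) :
    ∫ a, (f a : ℝ) ∂μ = (∫⁻ a, (f a : ℝ≥0∞) ∂μ).toReal := by
  rw [integral_eq_lintegral_of_nonneg_ae (Eventually.of_forall fun a => Nat.cast_nonneg _)
    (measurable_of_countable _).aestronglyMeasurable]
  simp

open scoped NNReal ENNReal in
theorem integrable_natCast_of_lintegral_ne_top {A : Type*} [MeasurableSpace A] [Countable A]
    [MeasurableSingletonClass A] {μ : Measure A} {f : A → ℕ}
    (h : ∫⁻ a, (f a : ℝ≥0∞) ∂μ ≠ ⊤) : Integrable (fun a => (f a : ℝ)) μ := by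
  refine ⟨(measurable_of_countable _).aestronglyMeasurable, ?_⟩
  rw [hasFiniteIntegral_iff_ofReal (Eventually.of_forall fun a => Nat.cast_nonneg _)]
  simpa using h.lt_top

/-! ### The law of the new edges in one step. -/

section Attachment

open scoped NNReal ENNReal

variable {N m : ℕ}

/-- The attachment probability of a half-edge of type `i.1` at the vertex `i.2`. -/
noncomputable def attachmentWeight (g : TypedMultigraph N (Fin m)) (i : Fin N × Fin m) : ℝ≥0 :=
  (g.deg i.2 i.1 : ℝ≥0) / (2 * (g.totalEdgeCount : ℝ≥0))

/-- The law of the array of new edges when the parameter of the step is `l`. -/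
noncomputable def attachmentMeasure (g : TypedMultigraph N (Fin m)) (l : ℝ) :
    Measure (Fin N × Fin m → ℕ) :=
  Measure.pi fun i => poissonMeasure (l.toNNReal * attachmentWeight g i)

instance (g : TypedMultigraph N (Fin m)) (l : ℝ) : IsProbabilityMeasure (attachmentMeasure g l) := by
  unfold attachmentMeasure; infer_instance

theorem measurable_attachmentMeasure (g : TypedMultigraph N (Fin m)) :
    Measurable (attachmentMeasure g) := by
  refine Measure.measurable_of_measurable_coe _ fun s hs => ?_
  simp_rw [← Measure.tsum_indicator_apply_singleton _ s hs]
  refine Measurable.tsum fun a => ?_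
  by_cases ha : a ∈ s
  · simp only [ha, Set.indicator_of_mem, attachmentMeasure, Measure.pi_singleton,
      poissonMeasure_singleton]
    fun_prop
  · simp [ha]

variable {Ω : Type*} [MeasurableSpace Ω]

/-- The law of the array of new edges when the parameter of the step is random. -/
noncomputable def attachmentKernel (P : Measure Ω) (Λ : Ω → ℝ) :
    Kernel (TypedMultigraph N (Fin m)) (Fin N × Fin m → ℕ) :=
  Kernel.ofFunOfCountable fun g => P.bind fun ω => attachmentMeasure g (Λ ω)

variable {P : Measure Ω} {Λ : Ω → ℝ} (hΛ : Measurable Λ) (g : TypedMultigraph N (Fin m))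

include hΛ

theorem lintegral_attachmentKernel (F : (Fin N × Fin m → ℕ) → ℝ≥0∞) :
    ∫⁻ a, F a ∂(attachmentKernel P Λ g) = ∫⁻ ω, ∫⁻ a, F a ∂(attachmentMeasure g (Λ ω)) ∂P :=
  Measure.lintegral_bind ((measurable_attachmentMeasure g).comp hΛ).aemeasurable
    (measurable_of_countable _).aemeasurable

theorem attachmentKernel_apply (s : Set (Fin N × Fin m → ℕ)) :
    attachmentKernel P Λ g s = ∫⁻ ω, attachmentMeasure g (Λ ω) s ∂P :=
  Measure.bind_apply (Set.to_countable s).measurableSet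
    ((measurable_attachmentMeasure g).comp hΛ).aemeasurable

theorem isMarkovKernel_attachmentKernel [IsProbabilityMeasure P] :
    IsMarkovKernel (attachmentKernel P Λ : Kernel (TypedMultigraph N (Fin m)) _) :=
  ⟨fun g => ⟨by rw [attachmentKernel_apply hΛ]; simp⟩⟩

theorem lintegral_sum_attachmentKernel (S : Finset (Fin N × Fin m)) :
    ∫⁻ a, ((∑ i ∈ S, a i : ℕ) : ℝ≥0∞) ∂(attachmentKernel P Λ g) =
      (∫⁻ ω, ENNReal.ofReal (Λ ω) ∂P) * ((∑ i ∈ S, attachmentWeight g i : ℝ≥0) : ℝ≥0∞) := by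
  rw [lintegral_attachmentKernel hΛ, ← lintegral_mul_const _ hΛ.ennreal_ofReal]
  refine lintegral_congr fun ω => ?_
  rw [attachmentMeasure, lintegral_poisson_sum, ENNReal.ofNNReal_finsetSum, Finset.mul_sum]
  rfl

theorem lintegral_sum_mul_pred_attachmentKernel (S : Finset (Fin N × Fin m)) :
    ∫⁻ a, (((∑ i ∈ S, a i) * ((∑ i ∈ S, a i) - 1) : ℕ) : ℝ≥0∞) ∂(attachmentKernel P Λ g) =
      (∫⁻ ω, ENNReal.ofReal (Λ ω) ^ 2 ∂P) *
        ((∑ i ∈ S, attachmentWeight g i : ℝ≥0) : ℝ≥0∞) ^ 2 := by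
  rw [lintegral_attachmentKernel hΛ, ← lintegral_mul_const _ (hΛ.ennreal_ofReal.pow_const 2)]
  refine lintegral_congr fun ω => ?_
  rw [attachmentMeasure, lintegral_poisson_sum_mul_pred, ENNReal.ofNNReal_finsetSum, ← mul_pow,
    Finset.mul_sum]
  rfl

omit hΛ

theorem attachmentMeasure_rowSum_eq (l : ℝ) (d : Fin N → ℕ) :
    attachmentMeasure g l {a | (fun k => ∑ w, a (k, w)) = d} =
      ∏ k, poissonMeasure (l.toNNReal * ∑ w, attachmentWeight g (k, w)) {d k} := by
  rw [attachmentMeasure, poisson_rowSum_eq]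
  simp_rw [Finset.mul_sum]

variable {g} in
theorem sum_attachmentWeight_row (hg : 0 < g.totalEdgeCount) (k : Fin N) :
    ∑ w, attachmentWeight g (k, w) = (g.edgeCount k : ℝ≥0) / (g.totalEdgeCount : ℝ≥0) := by
  have h := g.sum_deg_eq_two_mul_edgeCount k
  have hg' : (g.totalEdgeCount : ℝ≥0) ≠ 0 := by positivity
  simp only [attachmentWeight]
  rw [← Finset.sum_div, ← Nat.cast_sum, h]
  push_cast
  field_simp

variable {g} in
theorem sum_attachmentWeight (hg : 0 < g.totalEdgeCount) :
    ∑ i, attachmentWeight g i = 1 := by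
  rw [Fintype.sum_prod_type]
  simp_rw [sum_attachmentWeight_row hg]
  have hg' : (g.totalEdgeCount : ℝ≥0) ≠ 0 := by positivity
  rw [← Finset.sum_div, ← Nat.cast_sum]
  exact div_self hg'

/-- In a graph without edges the weights are divisions by zero, hence 0, so moment bounds hold for
every graph. -/
theorem sum_attachmentWeight_le : ∑ i, attachmentWeight g i ≤ 1 := by
  rcases Nat.eq_zero_or_pos g.totalEdgeCount with h | h
  · simp [attachmentWeight, h]
  · exact (sum_attachmentWeight h).le

theorem sum_attachmentWeight_column (w : Fin m) :
    ∑ k, attachmentWeight g (k, w) =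
      ((∑ k, g.deg w k : ℕ) : ℝ≥0) / (2 * (g.totalEdgeCount : ℝ≥0)) := by
  simp [attachmentWeight, Finset.sum_div]

/-- The number of new edges of one type is a size-biased share of the number of new edges. -/
theorem lintegral_rowSum_mul_attachmentMeasure (hg : 0 < g.totalEdgeCount) (l : ℝ) (k : Fin N)
    (F : ℕ → ℝ≥0∞) :
    ∫⁻ a, ((∑ w, a (k, w) : ℕ) : ℝ≥0∞) * F (∑ i, a i) ∂(attachmentMeasure g l) =
      ((∑ w, attachmentWeight g (k, w) : ℝ≥0) : ℝ≥0∞) *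
        ∫⁻ a, ((∑ i, a i : ℕ) : ℝ≥0∞) * F (∑ i, a i) ∂(attachmentMeasure g l) := by
  -- For any set S of cells, size biasing gives the weight of S times a quantity independent of S.
  -- Comparing row k with the set of all cells, of weight 1, gives the claim.
  have hS : ∀ S : Finset (Fin N × Fin m),
      ∫⁻ a, ((∑ i ∈ S, a i : ℕ) : ℝ≥0∞) * F (∑ i, a i) ∂(attachmentMeasure g l) =
        ((∑ i ∈ S, attachmentWeight g i : ℝ≥0) : ℝ≥0∞) *
          ((l.toNNReal : ℝ≥0∞) * ∫⁻ a, F (∑ i, a i + 1) ∂(attachmentMeasure g l)) := by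
    intro S
    rw [attachmentMeasure, lintegral_poisson_sum_mul, ENNReal.ofNNReal_finsetSum, Finset.sum_mul]
    refine Finset.sum_congr rfl fun i _ => ?_
    simp only [Pi.add_apply, Finset.sum_add_distrib, Finset.sum_pi_single', Finset.mem_univ,
      if_true, ENNReal.coe_mul]
    ring
  have h1 := hS (Finset.univ.map (Function.Embedding.sectR k (Fin m)))
  simp only [Finset.sum_map, Function.Embedding.sectR_apply] at h1
  rw [h1, hS, sum_attachmentWeight hg, ENNReal.coe_one, one_mul]

include hΛ in
-- Let p be the present share of type k. Size biasing with F(t) = 1/(|E| + t) replaces the numerator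
-- by p(|E| + T), T being the number of new edges, and the denominator cancels. This holds for each
-- fixed parameter, hence after mixing.
theorem lintegral_edgeProportion_attachmentKernel [IsProbabilityMeasure P]
    (hg : 0 < g.totalEdgeCount) (k : Fin N) :
    ∫⁻ a, ((g.edgeCount k + ∑ w, a (k, w) : ℕ) : ℝ≥0∞) *
        ((g.totalEdgeCount + ∑ i, a i : ℕ) : ℝ≥0∞)⁻¹ ∂(attachmentKernel P Λ g) =
      ((∑ w, attachmentWeight g (k, w) : ℝ≥0) : ℝ≥0∞) := by
  have key : ∀ l, ∫⁻ a, ((g.edgeCount k + ∑ w, a (k, w) : ℕ) : ℝ≥0∞) *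
      ((g.totalEdgeCount + ∑ i, a i : ℕ) : ℝ≥0∞)⁻¹ ∂(attachmentMeasure g l) =
      ((∑ w, attachmentWeight g (k, w) : ℝ≥0) : ℝ≥0∞) := by
    intro l
    set p : ℝ≥0 := ∑ w, attachmentWeight g (k, w) with hp
    have hE : (g.edgeCount k : ℝ≥0∞) = p * (g.totalEdgeCount : ℝ≥0∞) := by
      have hg' : (g.totalEdgeCount : ℝ≥0) ≠ 0 := by positivity
      have : (g.edgeCount k : ℝ≥0) = p * (g.totalEdgeCount : ℝ≥0) := by
        rw [hp, sum_attachmentWeight_row hg]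
        field_simp
      exact_mod_cast congrArg ((↑) : ℝ≥0 → ℝ≥0∞) this
    have h := lintegral_rowSum_mul_attachmentMeasure g hg l k
      fun t => ((g.totalEdgeCount + t : ℕ) : ℝ≥0∞)⁻¹
    simp_rw [Nat.cast_add (g.edgeCount k), add_mul]
    rw [lintegral_add_left (measurable_of_countable _), h, hE]
    simp_rw [mul_assoc]
    rw [lintegral_const_mul _ (measurable_of_countable _), ← mul_add,
      ← lintegral_add_left (measurable_of_countable _)]
    simp_rw [← add_mul, ← Nat.cast_add]
    have : ∀ a : Fin N × Fin m → ℕ, ((g.totalEdgeCount + ∑ i, a i : ℕ) : ℝ≥0∞) *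
        ((g.totalEdgeCount + ∑ i, a i : ℕ) : ℝ≥0∞)⁻¹ = 1 := fun a =>
      ENNReal.mul_inv_cancel (by simp; omega) (ENNReal.natCast_ne_top _)
    simp only [this, lintegral_const, measure_univ, mul_one]
  rw [lintegral_attachmentKernel hΛ]
  simp only [key, lintegral_const, measure_univ, mul_one]

end Attachment

open scoped NNReal ENNReal in
theorem abs_integral_le_of_lintegral_sq_le {A : Type*} [MeasurableSpace A] {μ : Measure A}
    [IsProbabilityMeasure μ] {f : A → ℝ} (hf : Measurable f) {C : ℝ≥0}
    (h : ∫⁻ a, ENNReal.ofReal (f a ^ 2) ∂μ ≤ C) : |∫ a, f a ∂μ| ≤ 1 + C := by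
  have hi : Integrable (fun a => f a ^ 2) μ := by
    refine ⟨(hf.pow_const 2).aestronglyMeasurable, ?_⟩
    rw [hasFiniteIntegral_iff_ofReal (Eventually.of_forall fun ω => sq_nonneg _)]
    exact h.trans_lt ENNReal.coe_lt_top
  have h1 : ∫ a, f a ^ 2 ∂μ ≤ C := by
    rw [integral_eq_lintegral_of_nonneg_ae (Eventually.of_forall fun ω => sq_nonneg _)
      hi.aestronglyMeasurable]
    exact ENNReal.toReal_le_coe_of_le_coe h
  have h2 : ∫ a, (1 + f a ^ 2) ∂μ = 1 + ∫ a, f a ^ 2 ∂μ := by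
    rw [integral_add (integrable_const 1) hi]; simp
  have h3 : ∀ a, ‖f a‖ ≤ 1 + f a ^ 2 := fun a => by
    rw [Real.norm_eq_abs]
    nlinarith [sq_nonneg (|f a| - 1), sq_abs (f a)]
  have h4 := norm_integral_le_of_norm_le (f := f) (g := fun a => 1 + f a ^ 2)
    ((integrable_const 1).add hi) (Eventually.of_forall h3)
  rw [h2, Real.norm_eq_abs] at h4
  linarith

/-! ### The step law given the past, and the strong law for step functionals. -/

section Model

open scoped NNReal ENNReal

variable {Ω : Type*} [mΩ : MeasurableSpace Ω] {P : Measure Ω} {N s : ℕ}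
  {g₀ : TypedMultigraph N (Fin s)} {lam : ℕ → Ω → ℝ}
  {G : (n : ℕ) → Ω → TypedMultigraph N (Fin (s + n))}

/-- The array of new edges of step `n + 1`. -/
def newEdgeArray (G : (n : ℕ) → Ω → TypedMultigraph N (Fin (s + n))) (n : ℕ) (ω : Ω) :
    Fin N × Fin (s + n) → ℕ :=
  fun i => newEdges G n i.1 i.2 ω

theorem graphHistory_le (hG : IsIndependentEdgesModel P g₀ lam G) (n : ℕ) :
    graphHistory G n ≤ mΩ :=
  iSup₂_le fun i _ => (hG.measurable_graph i).comap_le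

/-- The filtration generated by the graphs. -/
def graphFiltration (hG : IsIndependentEdgesModel P g₀ lam G) : Filtration ℕ mΩ where
  seq := graphHistory G
  mono' _ _ h := biSup_mono fun _ hi => ⟨hi.1, hi.2.trans h⟩
  le' := graphHistory_le hG

theorem measurable_graphHistory (hG : IsIndependentEdgesModel P g₀ lam G) (n : ℕ) :
    Measurable[graphHistory G n] (G n) := by
  rcases Nat.eq_zero_or_pos n with rfl | hn
  · have : G 0 = fun _ => g₀ := funext hG.initial
    rw [this]
    exact measurable_const
  · exact (comap_measurable (G n)).mono
      (le_iSup₂ (f := fun i (_ : i ∈ Set.Icc 1 n) => MeasurableSpace.comap (G i) inferInstance)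
        n ⟨hn, le_rfl⟩) le_rfl

theorem measurable_newEdgeArray_history (hG : IsIndependentEdgesModel P g₀ lam G) (n : ℕ) :
    Measurable[graphHistory G (n + 1)] (newEdgeArray G n) := by
  have h : Measurable fun (g : TypedMultigraph N (Fin (s + (n + 1)))) (i : Fin N × Fin (s + n)) =>
    g.mult i.1 s(i.2.castSucc, Fin.last (s + n)) := measurable_from_top
  exact h.comp (measurable_graphHistory hG (n + 1))

theorem measurable_newEdgeArray (hG : IsIndependentEdgesModel P g₀ lam G) (n : ℕ) :
    Measurable (newEdgeArray G n) :=
  (measurable_newEdgeArray_history hG n).mono (graphHistory_le hG _) le_rfl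

/-- The model prescribes the law given the past and the parameter of the step. On an event of the
past where G_n = g, the Poisson weight depends on the parameter only, and independence (IE1) lets it
be averaged out. -/
theorem measure_inter_newEdgeArray_eq [IsProbabilityMeasure P]
    (hG : IsIndependentEdgesModel P g₀ lam G) (hIE1 : AssumptionIE1 P lam G) (n : ℕ)
    (B : Set Ω) (hB : MeasurableSet[graphHistory G n] B)
    (g : TypedMultigraph N (Fin (s + n))) (a : Fin N × Fin (s + n) → ℕ) :
    P (B ∩ G n ⁻¹' {g} ∩ newEdgeArray G n ⁻¹' {a}) =
      P (B ∩ G n ⁻¹' {g}) * attachmentKernel P (lam (n + 1)) g {a} := by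
  have hle := graphHistory_le hG n
  have hlam := hIE1.measurable n
  have hleP : graphHistoryPlus G lam n ≤ mΩ := sup_le hle hlam.comap_le
  set B' := B ∩ G n ⁻¹' {g} with hB'
  have hBm : MeasurableSet[graphHistory G n] B' :=
    MeasurableSet.inter hB (measurable_graphHistory hG n trivial)
  have hBm0 : MeasurableSet B' := hle _ hBm
  have hYm : MeasurableSet (newEdgeArray G n ⁻¹' {a}) :=
    measurable_newEdgeArray hG n (measurableSet_singleton a)
  have hset : {ω | ∀ k w, newEdges G n k w ω = a (k, w)} = newEdgeArray G n ⁻¹' {a} := by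
    ext ω
    simp [newEdgeArray, funext_iff, Prod.forall]
  have hf : Measurable fun l => attachmentMeasure g l {a} :=
    (Measure.measurable_coe (measurableSet_singleton a)).comp (measurable_attachmentMeasure g)
  have h1 := hG.new_edges n fun k w => a (k, w)
  rw [hset] at h1
  have hint : Integrable (Set.indicator (newEdgeArray G n ⁻¹' {a}) fun _ => (1 : ℝ)) P :=
    (integrable_const 1).indicator hYm
  have h2 := setIntegral_condExp hleP hint
    ((le_sup_left : graphHistory G n ≤ graphHistoryPlus G lam n) _ hBm)
  have h3 : ∫ ω in B', (attachmentMeasure g (lam (n + 1) ω) {a}).toReal ∂P =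
      ∫ ω in B', (newEdgeArray G n ⁻¹' {a}).indicator (fun _ => (1 : ℝ)) ω ∂P := by
    rw [← h2]
    refine setIntegral_congr_ae hBm0 ?_
    filter_upwards [h1] with ω hω hωB
    rw [hω, attachmentMeasure, Measure.pi_singleton, ENNReal.toReal_prod, Fintype.prod_prod_type]
    refine Finset.prod_congr rfl fun k _ => Finset.prod_congr rfl fun w _ => ?_
    have hg : G n ω = g := hωB.2
    rw [measureReal_def, attachmentRate, hg]
    congr 3
    rw [mul_comm (lam (n + 1) ω), Real.toNNReal_mul (by positivity), mul_comm]
    congr 1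
    rw [attachmentWeight, Real.toNNReal_div' (by positivity), Real.toNNReal_mul (by norm_num)]
    simp
  rw [integral_toReal (f := fun ω => attachmentMeasure g (lam (n + 1) ω) {a})
    (hf.comp hlam).aemeasurable (Eventually.of_forall fun _ => measure_lt_top _ _),
    integral_indicator hYm, Measure.restrict_restrict hYm, setIntegral_const, smul_eq_mul, mul_one,
    measureReal_def, Set.inter_comm] at h3
  have hfin : ∫⁻ ω in B', attachmentMeasure g (lam (n + 1) ω) {a} ∂P ≠ ⊤ := by
    refine ((lintegral_mono fun ω => prob_le_one).trans_lt (?_ : ∫⁻ _ in B', 1 ∂P < ⊤)).ne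
    simp [measure_lt_top]
  rw [ENNReal.toReal_eq_toReal_iff' hfin (measure_ne_top _ _)] at h3
  rw [← h3, attachmentKernel_apply hlam, ← lintegral_indicator hBm0]
  have h4 := lintegral_mul_eq_lintegral_mul_lintegral_of_independent_measurableSpace
    (f := B'.indicator fun _ => (1 : ℝ≥0∞))
    (g := fun ω => attachmentMeasure g (lam (n + 1) ω) {a}) hle hlam.comap_le
    (hIE1.indep n).symm (measurable_const.indicator hBm) (hf.comp (comap_measurable _))
  rw [lintegral_indicator_const hBm0, one_mul] at h4
  rw [← h4]
  refine lintegral_congr fun ω => ?_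
  by_cases hω : ω ∈ B' <;> simp [hω]


theorem lintegral_newEdgeArray [IsProbabilityMeasure P]
    (hG : IsIndependentEdgesModel P g₀ lam G)
    (hIE1 : AssumptionIE1 P lam G) (n : ℕ)
    (F : TypedMultigraph N (Fin (s + n)) → (Fin N × Fin (s + n) → ℕ) → ℝ≥0∞) :
    ∫⁻ ω, F (G n ω) (newEdgeArray G n ω) ∂P =
      ∫⁻ ω, ∫⁻ a, F (G n ω) a ∂(attachmentKernel P (lam (n + 1)) (G n ω)) ∂P := by
  have := isMarkovKernel_attachmentKernel (P := P) (N := N) (m := s + n) (hIE1.measurable n)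
  exact lintegral_eq_lintegral_kernel (graphHistory_le hG n) (measurable_graphHistory hG n)
    (measurable_newEdgeArray hG n) (measure_inter_newEdgeArray_eq hG hIE1 n) F

theorem condExp_newEdgeArray [IsProbabilityMeasure P]
    (hG : IsIndependentEdgesModel P g₀ lam G)
    (hIE1 : AssumptionIE1 P lam G) (n : ℕ)
    (F : TypedMultigraph N (Fin (s + n)) → (Fin N × Fin (s + n) → ℕ) → ℝ)
    (hF : Integrable (fun ω => F (G n ω) (newEdgeArray G n ω)) P) :
    P[fun ω => F (G n ω) (newEdgeArray G n ω) | graphHistory G n] =ᵐ[P]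
      fun ω => ∫ a, F (G n ω) a ∂(attachmentKernel P (lam (n + 1)) (G n ω)) := by
  have := isMarkovKernel_attachmentKernel (P := P) (N := N) (m := s + n) (hIE1.measurable n)
  exact condExp_eq_integral_kernel (graphHistory_le hG n) (measurable_graphHistory hG n)
    (measurable_newEdgeArray hG n) (measure_inter_newEdgeArray_eq hG hIE1 n) F hF

theorem measurable_graph_newEdgeArray (hG : IsIndependentEdgesModel P g₀ lam G) (n : ℕ)
    (F : TypedMultigraph N (Fin (s + n)) → (Fin N × Fin (s + n) → ℕ) → ℝ) :
    Measurable[graphHistory G (n + 1)] fun ω => F (G n ω) (newEdgeArray G n ω) := by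
  have h1 : Measurable[graphHistory G (n + 1)] (G n) :=
    (measurable_graphHistory hG n).mono ((graphFiltration hG).mono n.le_succ) le_rfl
  have h2 : Measurable fun p : TypedMultigraph N (Fin (s + n)) × (Fin N × Fin (s + n) → ℕ) =>
    F p.1 p.2 := measurable_of_countable _
  exact h2.comp (h1.prodMk (measurable_newEdgeArray_history hG n))

/-- Strong law of large numbers for functionals of the steps of the model. -/
theorem ae_tendsto_average_sub_integral [IsProbabilityMeasure P]
    (hG : IsIndependentEdgesModel P g₀ lam G)
    (hIE1 : AssumptionIE1 P lam G)
    (F : ∀ n, TypedMultigraph N (Fin (s + n)) → (Fin N × Fin (s + n) → ℕ) → ℝ) (C : ℝ≥0) (n₀ : ℕ)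
    (hF : ∀ n ≥ n₀, ∀ ω, ∫⁻ a, ENNReal.ofReal (F n (G n ω) a ^ 2)
      ∂(attachmentKernel P (lam (n + 1)) (G n ω)) ≤ C) :
    ∀ᵐ ω ∂P, Tendsto (fun n : ℕ => (n : ℝ)⁻¹ * ∑ i ∈ Finset.range n,
      (F i (G i ω) (newEdgeArray G i ω) -
        ∫ a, F i (G i ω) a ∂(attachmentKernel P (lam (i + 1)) (G i ω)))) atTop (𝓝 0) := by
  set K : ℕ → Ω → ℝ := fun n ω =>
    ∫ a, F n (G n ω) a ∂(attachmentKernel P (lam (n + 1)) (G n ω)) with hK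
  set f : ℕ → Ω → ℝ := fun n ω => F n (G n ω) (newEdgeArray G n ω) with hf
  have hfm : ∀ n, Measurable[graphHistory G (n + 1)] (f n) := fun n =>
    measurable_graph_newEdgeArray hG n (F n)
  have hKm : ∀ n, Measurable[graphHistory G n] (K n) := fun n => by
    have h : Measurable fun g : TypedMultigraph N (Fin (s + n)) =>
      ∫ a, F n g a ∂(attachmentKernel P (lam (n + 1)) g) := measurable_from_top
    exact h.comp (measurable_graphHistory hG n)
  have hfsq : ∀ n ≥ n₀, ∫⁻ ω, ENNReal.ofReal (f n ω ^ 2) ∂P ≤ C := by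
    intro n hn
    rw [lintegral_newEdgeArray hG hIE1 n fun g a => ENNReal.ofReal (F n g a ^ 2)]
    refine (lintegral_mono fun ω => hF n hn ω).trans ?_
    simp
  have hfL : ∀ n ≥ n₀, MemLp (f n) 2 P := by
    intro n hn
    have hm : AEStronglyMeasurable (f n) P :=
      ((hfm n).mono (graphHistory_le hG _) le_rfl).aestronglyMeasurable
    rw [memLp_two_iff_integrable_sq hm]
    refine ⟨hm.pow 2, ?_⟩
    rw [hasFiniteIntegral_iff_ofReal (Eventually.of_forall fun ω => sq_nonneg _)]
    exact (hfsq n hn).trans_lt ENNReal.coe_lt_top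
  have hKcond : ∀ n ≥ n₀, P[f n | graphHistory G n] =ᵐ[P] K n := fun n hn =>
    condExp_newEdgeArray hG hIE1 n (F n) ((hfL n hn).integrable (by norm_num))
  have hKL : ∀ n ≥ n₀, MemLp (K n) 2 P := fun n hn =>
    (memLp_congr_ae (hKcond n hn)).1 ((hfL n hn).condExp (by norm_num))
  have hKle : ∀ n ≥ n₀, ∀ ω, |K n ω| ≤ 1 + C := by
    intro n hn ω
    have := isMarkovKernel_attachmentKernel (P := P) (N := N) (m := s + n) (hIE1.measurable n)
    exact abs_integral_le_of_lintegral_sq_le (measurable_of_countable _) (hF n hn ω)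
  -- The second moment bound is available only from n₀ on; dropping finitely many terms does not
  -- affect the averages.
  set D : ℕ → Ω → ℝ := fun n => if n₀ ≤ n then f n - K n else 0 with hD
  have key : ∀ᵐ ω ∂P, Tendsto (fun n : ℕ => (n : ℝ)⁻¹ * ∑ i ∈ Finset.range n, D i ω)
      atTop (𝓝 0) := by
    refine ae_tendsto_average_of_condExp_eq_zero (graphFiltration hG)
      (C := 2 * C + 2 * (1 + C) ^ 2) (fun n => ?_) (fun n => ?_) (fun n => ?_) fun n => ?_
    · simp only [hD]
      split_ifs with hn
      · exact ((hfm n).sub ((hKm n).mono ((graphFiltration hG).mono n.le_succ)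
          le_rfl)).stronglyMeasurable
      · exact stronglyMeasurable_zero
    · simp only [hD]
      split_ifs with hn
      · exact (hfL n hn).sub (hKL n hn)
      · exact MemLp.zero
    · simp only [hD]
      split_ifs with hn
      · have hfi : Integrable (fun ω => f n ω ^ 2) P := (hfL n hn).integrable_sq
        calc ∫ ω, (f n - K n) ω ^ 2 ∂P
            ≤ ∫ ω, (2 * f n ω ^ 2 + 2 * (1 + (C : ℝ)) ^ 2) ∂P := by
              refine integral_mono ((hfL n hn).sub (hKL n hn)).integrable_sq
                ((hfi.const_mul 2).add (integrable_const _)) fun ω => ?_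
              have h1 := hKle n hn ω
              have h2 : K n ω ^ 2 ≤ (1 + (C : ℝ)) ^ 2 := sq_le_sq' (abs_le.1 h1).1 (abs_le.1 h1).2
              simp only [Pi.sub_apply]
              nlinarith [sq_nonneg (f n ω + K n ω)]
          _ = 2 * ∫ ω, f n ω ^ 2 ∂P + 2 * (1 + (C : ℝ)) ^ 2 := by
              rw [integral_add (hfi.const_mul 2) (integrable_const _), integral_const_mul]; simp
          _ ≤ 2 * C + 2 * (1 + (C : ℝ)) ^ 2 := by
              gcongr
              rw [integral_eq_lintegral_of_nonneg_ae (Eventually.of_forall fun ω => sq_nonneg _)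
                hfi.aestronglyMeasurable]
              exact ENNReal.toReal_le_coe_of_le_coe (hfsq n hn)
      · simp
        positivity
    · simp only [hD]
      split_ifs with hn
      · have hfi : Integrable (f n) P := (hfL n hn).integrable (by norm_num)
        have hKi : Integrable (K n) P := (hKL n hn).integrable (by norm_num)
        filter_upwards [condExp_sub hfi hKi (graphHistory G n), hKcond n hn] with ω h1 h2
        refine h1.trans ?_
        rw [Pi.sub_apply, h2, condExp_of_stronglyMeasurable (graphHistory_le hG n)
          (hKm n).stronglyMeasurable hKi]
        simp
      · rw [condExp_zero]
  filter_upwards [key] with ω hω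
  have hdiff : Tendsto (fun n : ℕ => (n : ℝ)⁻¹ * ∑ i ∈ Finset.range n,
      (f i ω - K i ω - D i ω)) atTop (𝓝 0) := by
    refine Tendsto.cesaro (tendsto_const_nhds.congr' ?_)
    filter_upwards [eventually_ge_atTop n₀] with n hn
    simp [hD, hn]
  have := hω.add hdiff
  rw [add_zero] at this
  refine this.congr fun n => ?_
  rw [← mul_add, ← Finset.sum_add_distrib]
  simp only [add_sub_cancel, hf, hK]

end Model

/-! ### Conditional mean of the change of the degree counts. -/

section Drift

open scoped NNReal ENNReal

variable {Ω : Type*} [mΩ : MeasurableSpace Ω] {P : Measure Ω}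
  {N m : ℕ} {Λ : Ω → ℝ} {M₁ M₂ : ℝ≥0}

theorem integral_sum_attachmentKernel (hΛ : Measurable Λ)
    (h₁ : ∫⁻ ω, ENNReal.ofReal (Λ ω) ∂P = M₁) (g : TypedMultigraph N (Fin m))
    (S : Finset (Fin N × Fin m)) :
    Integrable (fun a => ((∑ i ∈ S, a i : ℕ) : ℝ)) (attachmentKernel P Λ g) ∧
      ∫ a, ((∑ i ∈ S, a i : ℕ) : ℝ) ∂(attachmentKernel P Λ g) =
        M₁ * (∑ i ∈ S, attachmentWeight g i : ℝ≥0) := by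
  have h := lintegral_sum_attachmentKernel (P := P) hΛ g S
  rw [h₁, ← ENNReal.coe_mul] at h
  refine ⟨integrable_natCast_of_lintegral_ne_top (by rw [h]; exact ENNReal.coe_ne_top), ?_⟩
  rw [integral_natCast_eq_toReal_lintegral, h, ENNReal.coe_toReal, NNReal.coe_mul]

theorem integral_sum_mul_pred_attachmentKernel (hΛ : Measurable Λ)
    (h₂ : ∫⁻ ω, ENNReal.ofReal (Λ ω) ^ 2 ∂P = M₂) (g : TypedMultigraph N (Fin m))
    (S : Finset (Fin N × Fin m)) :
    Integrable (fun a => (((∑ i ∈ S, a i) * ((∑ i ∈ S, a i) - 1) : ℕ) : ℝ))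
        (attachmentKernel P Λ g) ∧
      ∫ a, (((∑ i ∈ S, a i) * ((∑ i ∈ S, a i) - 1) : ℕ) : ℝ) ∂(attachmentKernel P Λ g) =
        M₂ * ((∑ i ∈ S, attachmentWeight g i : ℝ≥0) : ℝ) ^ 2 := by
  have h := lintegral_sum_mul_pred_attachmentKernel (P := P) hΛ g S
  rw [h₂, ← ENNReal.coe_pow, ← ENNReal.coe_mul] at h
  refine ⟨integrable_natCast_of_lintegral_ne_top (by rw [h]; exact ENNReal.coe_ne_top), ?_⟩
  rw [integral_natCast_eq_toReal_lintegral, h, ENNReal.coe_toReal, NNReal.coe_mul, NNReal.coe_pow]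

theorem lintegral_sq_attachmentKernel_le [IsProbabilityMeasure P] (hΛ : Measurable Λ)
    {C : ℝ≥0} (h₁ : ∫⁻ ω, ENNReal.ofReal (Λ ω) ∂P ≤ C)
    (h₂ : ∫⁻ ω, ENNReal.ofReal (Λ ω) ^ 2 ∂P ≤ C) (g : TypedMultigraph N (Fin m))
    {F : (Fin N × Fin m → ℕ) → ℝ} (hF : ∀ a, |F a| ≤ (∑ i, a i : ℕ) + 1) :
    ∫⁻ a, ENNReal.ofReal (F a ^ 2) ∂(attachmentKernel P Λ g) ≤ ((4 * C + 1 : ℝ≥0) : ℝ≥0∞) := by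
  have := isMarkovKernel_attachmentKernel (P := P) (N := N) (m := m) hΛ
  -- (T + 1)² = T(T - 1) + 3T + 1 for the number T of new edges; the three means are at most C, 3C
  -- and 1, whence 4C + 1.
  have hle : ∀ a : Fin N × Fin m → ℕ, ENNReal.ofReal (F a ^ 2) ≤
      (((∑ i, a i) * ((∑ i, a i) - 1) : ℕ) : ℝ≥0∞) + 3 * ((∑ i, a i : ℕ) : ℝ≥0∞) + 1 := by
    intro a
    have h := hF a
    set T := ∑ i, a i
    have h3 : ((T * (T - 1) : ℕ) : ℝ) = T * (T - 1) := by
      rcases T with _ | t <;> simp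
    have h4 : F a ^ 2 ≤ ((T * (T - 1) + 3 * T + 1 : ℕ) : ℝ) := by
      rw [Nat.cast_add, Nat.cast_add, h3]
      push_cast
      have := sq_le_sq' (abs_le.1 h).1 (abs_le.1 h).2
      linarith
    refine (ENNReal.ofReal_le_ofReal h4).trans ?_
    rw [ENNReal.ofReal_natCast]
    push_cast
    rfl
  have hw : ((∑ i, attachmentWeight g i : ℝ≥0) : ℝ≥0∞) ≤ 1 := by
    exact_mod_cast sum_attachmentWeight_le g
  refine (lintegral_mono hle).trans ?_
  rw [lintegral_add_right _ measurable_const, lintegral_add_left (measurable_of_countable _),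
    lintegral_const_mul _ (measurable_of_countable _), lintegral_sum_attachmentKernel hΛ,
    lintegral_sum_mul_pred_attachmentKernel hΛ, lintegral_const, measure_univ, mul_one]
  calc _ ≤ (C : ℝ≥0∞) * 1 ^ 2 + 3 * (C * 1) + 1 := by gcongr
    _ = ((4 * C + 1 : ℝ≥0) : ℝ≥0∞) := by push_cast; ring

/-- The change of the number of vertices of degree `d` when the array `a` of edges is added. -/
noncomputable def degreeCountIncrement (d : Fin N → ℕ) (g : TypedMultigraph N (Fin m))
    (a : Fin N × Fin m → ℕ) : ℝ :=
  (∑ w, ((if (g.deg w + fun k => a (k, w)) = d then (1 : ℝ) else 0) -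
    if g.deg w = d then 1 else 0)) + if (fun k => ∑ w, a (k, w)) = d then 1 else 0

/-- An old vertex changes class only if it receives an edge, and the new vertex contributes at most
1. -/
theorem abs_degreeCountIncrement_le (d : Fin N → ℕ) (g : TypedMultigraph N (Fin m))
    (a : Fin N × Fin m → ℕ) : |degreeCountIncrement d g a| ≤ (∑ i, a i : ℕ) + 1 := by
  refine (abs_add_le _ _).trans (add_le_add ?_ (by split_ifs <;> simp))
  refine (Finset.abs_sum_le_sum_abs _ _).trans ?_
  rw [Fintype.sum_prod_type_right, Nat.cast_sum]
  refine Finset.sum_le_sum fun w _ => ?_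
  by_cases h : (fun k => a (k, w)) = 0
  · simp [h]
  · obtain ⟨k, hk⟩ := Function.ne_iff.1 h
    have h1 : a (k, w) ≤ ∑ k, a (k, w) :=
      Finset.single_le_sum (f := fun k => a (k, w)) (fun _ _ => Nat.zero_le _) (Finset.mem_univ k)
    have h2 : 1 ≤ ∑ k, a (k, w) := (Nat.one_le_iff_ne_zero.2 hk).trans h1
    have h3 : (1 : ℝ) ≤ (∑ k, a (k, w) : ℕ) := by exact_mod_cast h2
    refine le_trans ?_ h3
    split_ifs <;> simp

theorem sum_ite_deg_eq (g : TypedMultigraph N (Fin m)) (d : Fin N → ℕ) (f : (Fin N → ℕ) → ℝ) :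
    ∑ w, (if g.deg w = d then f (g.deg w) else 0) = g.degreeCount d * f d := by
  rw [TypedMultigraph.degreeCount, ← Finset.sum_filter,
    Finset.sum_congr rfl fun w hw => by rw [(Finset.mem_filter.1 hw).2], Finset.sum_const,
    nsmul_eq_mul]

/-- Source of the coefficient d_k - 1: a vertex about to enter class d through an edge of type k has
d_k - 1 such edges, and attracts a new one in proportion to that number. -/
theorem sum_ite_deg_add_single_eq (g : TypedMultigraph N (Fin m)) (d : Fin N → ℕ) (k : Fin N) :
    ∑ w, (if g.deg w + Pi.single k 1 = d then (g.deg w k : ℝ) else 0) =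
      if 0 < d k then ((d k : ℝ) - 1) * g.degreeCount (d - Pi.single k 1) else 0 := by
  split_ifs with hd
  · have h : ∀ w, g.deg w + Pi.single k 1 = d ↔ g.deg w = d - Pi.single k 1 := by
      have hle : Pi.single k 1 ≤ d := by
        intro j
        by_cases hj : j = k
        · subst hj; simpa using Nat.succ_le_of_lt hd
        · simp [Pi.single_eq_of_ne hj]
      exact fun w => (eq_tsub_iff_add_eq_of_le hle).symm
    simp_rw [h]
    rw [sum_ite_deg_eq g _ fun d' => (d' k : ℝ), mul_comm]
    simp [Nat.cast_sub (Nat.succ_le_of_lt hd)]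
  · refine Finset.sum_eq_zero fun w _ => if_neg ?_
    rintro rfl
    simp at hd

/-- The first-order expansion of the indicator is integrated: linear terms give the rates of leaving
and entering class d, and the second factorial moment bounds the rest. Because of the cutoff, the
degree of w in the error is replaced by the total of d, so the bound is uniform in w. -/
theorem abs_integral_indicator_deg_sub_le [IsProbabilityMeasure P] (hΛ : Measurable Λ)
    (h₁ : ∫⁻ ω, ENNReal.ofReal (Λ ω) ∂P = M₁) (h₂ : ∫⁻ ω, ENNReal.ofReal (Λ ω) ^ 2 ∂P = M₂)
    (g : TypedMultigraph N (Fin m)) (d : Fin N → ℕ) (w : Fin m) :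
    |∫ a, (if (g.deg w + fun k => a (k, w)) = d then (1 : ℝ) else 0) ∂(attachmentKernel P Λ g) -
      ((if g.deg w = d then
          1 - M₁ * (((∑ k, g.deg w k : ℕ) : ℝ) / (2 * g.totalEdgeCount)) else 0) +
        ∑ k, M₁ / (2 * g.totalEdgeCount) *
          if g.deg w + Pi.single k 1 = d then (g.deg w k : ℝ) else 0)| ≤
      M₂ * (((∑ k, d k : ℕ) : ℝ) / (2 * g.totalEdgeCount)) ^ 2 := by
  have := isMarkovKernel_attachmentKernel (P := P) (N := N) (m := m) hΛ
  set μ := attachmentKernel P Λ g with hμ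
  have e : ∀ a : Fin N × Fin m → ℕ, ∑ i ∈ Finset.univ.map (Function.Embedding.sectL (Fin N) w),
      a i = ∑ k, a (k, w) := fun a => by simp
  have ew : ∑ i ∈ Finset.univ.map (Function.Embedding.sectL (Fin N) w), attachmentWeight g i =
      ((∑ k, g.deg w k : ℕ) : ℝ≥0) / (2 * (g.totalEdgeCount : ℝ≥0)) := by
    rw [← sum_attachmentWeight_column]; simp
  obtain ⟨i1, v1⟩ := integral_sum_attachmentKernel hΛ h₁ g
    (Finset.univ.map (Function.Embedding.sectL (Fin N) w))
  obtain ⟨i2, v2⟩ := integral_sum_mul_pred_attachmentKernel hΛ h₂ g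
    (Finset.univ.map (Function.Embedding.sectL (Fin N) w))
  simp_rw [e, ew] at i1 v1 i2 v2
  have i3 : ∀ k, Integrable (fun a : Fin N × Fin m → ℕ => (a (k, w) : ℝ)) μ := fun k => by
    simpa using (integral_sum_attachmentKernel hΛ h₁ g {(k, w)}).1
  have v3 : ∀ k, ∫ a : Fin N × Fin m → ℕ, (a (k, w) : ℝ) ∂μ =
      M₁ * ((g.deg w k : ℝ) / (2 * g.totalEdgeCount)) := fun k => by
    simpa [attachmentWeight] using (integral_sum_attachmentKernel hΛ h₁ g {(k, w)}).2
  have ind : Integrable (fun a : Fin N × Fin m → ℕ =>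
      if (g.deg w + fun k => a (k, w)) = d then (1 : ℝ) else 0) μ :=
    Integrable.of_bound (measurable_of_countable _).aestronglyMeasurable 1
      (Eventually.of_forall fun a => by split_ifs <;> simp)
  have j1 : Integrable (fun a : Fin N × Fin m → ℕ =>
      if g.deg w = d then 1 - ((∑ k, a (k, w) : ℕ) : ℝ) else 0) μ := by
    split_ifs
    · exact (integrable_const 1).sub i1
    · exact integrable_const 0
  have j2 : ∀ k, Integrable (fun a : Fin N × Fin m → ℕ =>
      if g.deg w + Pi.single k 1 = d then (a (k, w) : ℝ) else 0) μ := by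
    intro k
    split_ifs
    · exact i3 k
    · exact integrable_const 0
  have w1 : ∫ a : Fin N × Fin m → ℕ,
      (if g.deg w = d then 1 - ((∑ k, a (k, w) : ℕ) : ℝ) else 0) ∂μ =
      if g.deg w = d then
          1 - M₁ * (((∑ k, g.deg w k : ℕ) : ℝ) / (2 * g.totalEdgeCount)) else 0 := by
    split_ifs
    · rw [integral_sub (integrable_const 1) i1, v1]
      simp
    · simp
  have w2 : ∀ k, ∫ a : Fin N × Fin m → ℕ,
      (if g.deg w + Pi.single k 1 = d then (a (k, w) : ℝ) else 0) ∂μ =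
      M₁ / (2 * g.totalEdgeCount) *
          if g.deg w + Pi.single k 1 = d then (g.deg w k : ℝ) else 0 := by
    intro k
    split_ifs
    · rw [v3]; ring
    · simp
  have hbound := fun a : Fin N × Fin m → ℕ =>
    abs_indicator_add_eq_sub_le d (g.deg w) fun k => a (k, w)
  have jb : Integrable (fun a : Fin N × Fin m → ℕ => if ∑ k, g.deg w k ≤ ∑ k, d k then
      (((∑ k, a (k, w)) * ((∑ k, a (k, w)) - 1) : ℕ) : ℝ) else 0) μ := by
    split_ifs
    · exact i2
    · exact integrable_const 0
  have j3 : Integrable (fun a : Fin N × Fin m → ℕ =>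
      ∑ k, if g.deg w + Pi.single k 1 = d then (a (k, w) : ℝ) else 0) μ :=
    integrable_finsetSum _ fun k _ => j2 k
  have j4 : Integrable (fun a : Fin N × Fin m → ℕ =>
      (if g.deg w = d then 1 - ((∑ k, a (k, w) : ℕ) : ℝ) else 0) +
        ∑ k, if g.deg w + Pi.single k 1 = d then (a (k, w) : ℝ) else 0) μ := j1.add j3
  have h := norm_integral_le_of_norm_le (f := fun a : Fin N × Fin m → ℕ =>
    (if (g.deg w + fun k => a (k, w)) = d then (1 : ℝ) else 0) -
      ((if g.deg w = d then 1 - ((∑ k, a (k, w) : ℕ) : ℝ) else 0) +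
        ∑ k, if g.deg w + Pi.single k 1 = d then (a (k, w) : ℝ) else 0))
    jb (Eventually.of_forall hbound)
  rw [integral_sub ind j4, integral_add j1 j3,
    integral_finsetSum _ fun k _ => j2 k, w1] at h
  simp_rw [w2] at h
  refine h.trans ?_
  split_ifs with hle
  · rw [v2]
    have hle' : ((∑ k, g.deg w k : ℕ) : ℝ) ≤ (∑ k, d k : ℕ) := by exact_mod_cast hle
    push_cast at hle' ⊢
    gcongr
  · simp only [integral_zero]
    positivity

/-- The drift of the number of vertices of degree `d`. -/
theorem abs_integral_degreeCountIncrement_sub_le [IsProbabilityMeasure P] (hΛ : Measurable Λ)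
    (h₁ : ∫⁻ ω, ENNReal.ofReal (Λ ω) ∂P = M₁) (h₂ : ∫⁻ ω, ENNReal.ofReal (Λ ω) ^ 2 ∂P = M₂)
    (g : TypedMultigraph N (Fin m)) (d : Fin N → ℕ) :
    |∫ a, degreeCountIncrement d g a ∂(attachmentKernel P Λ g) -
      (-(M₁ / (2 * g.totalEdgeCount) * (∑ k, d k : ℕ) * g.degreeCount d) +
        (∑ k, M₁ / (2 * g.totalEdgeCount) *
          if 0 < d k then ((d k : ℝ) - 1) * g.degreeCount (d - Pi.single k 1) else 0) +
        (attachmentKernel P Λ g).real {a | (fun k => ∑ w, a (k, w)) = d})| ≤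
      m * (M₂ * (((∑ k, d k : ℕ) : ℝ) / (2 * g.totalEdgeCount)) ^ 2) := by
  have := isMarkovKernel_attachmentKernel (P := P) (N := N) (m := m) hΛ
  set μ := attachmentKernel P Λ g with hμ
  have ind : ∀ w, Integrable (fun a : Fin N × Fin m → ℕ =>
      if (g.deg w + fun k => a (k, w)) = d then (1 : ℝ) else 0) μ := fun w =>
    Integrable.of_bound (measurable_of_countable _).aestronglyMeasurable 1
      (Eventually.of_forall fun a => by split_ifs <;> simp)
  have ind' : Integrable (fun a : Fin N × Fin m → ℕ =>
      if (fun k => ∑ w, a (k, w)) = d then (1 : ℝ) else 0) μ :=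
    Integrable.of_bound (measurable_of_countable _).aestronglyMeasurable 1
      (Eventually.of_forall fun a => by split_ifs <;> simp)
  have hq : ∫ a : Fin N × Fin m → ℕ, (if (fun k => ∑ w, a (k, w)) = d then (1 : ℝ) else 0) ∂μ =
      μ.real {a | (fun k => ∑ w, a (k, w)) = d} := by
    rw [← integral_indicator_one (Set.to_countable _).measurableSet]
    refine integral_congr_ae (Eventually.of_forall fun a => ?_)
    simp [Set.indicator_apply]
  have hI : ∫ a, degreeCountIncrement d g a ∂μ =
      (∑ w, (∫ a : Fin N × Fin m → ℕ,
        (if (g.deg w + fun k => a (k, w)) = d then (1 : ℝ) else 0) ∂μ -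
          if g.deg w = d then 1 else 0)) + μ.real {a | (fun k => ∑ w, a (k, w)) = d} := by
    have i1 : ∀ w, Integrable (fun a : Fin N × Fin m → ℕ =>
        (if (g.deg w + fun k => a (k, w)) = d then (1 : ℝ) else 0) -
          if g.deg w = d then 1 else 0) μ := fun w => (ind w).sub (integrable_const _)
    have i2 : Integrable (fun a : Fin N × Fin m → ℕ =>
        ∑ w, ((if (g.deg w + fun k => a (k, w)) = d then (1 : ℝ) else 0) -
          if g.deg w = d then 1 else 0)) μ := integrable_finsetSum _ fun w _ => i1 w
    unfold degreeCountIncrement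
    rw [integral_add i2 ind', integral_finsetSum _ fun w _ => i1 w, hq]
    congr 1
    refine Finset.sum_congr rfl fun w _ => ?_
    rw [integral_sub (ind w) (integrable_const _)]
    simp
  have hX : (g.degreeCount d : ℝ) = ∑ w, if g.deg w = d then (1 : ℝ) else 0 := by
    simpa using (sum_ite_deg_eq g d fun _ => 1).symm
  have hL : -(M₁ / (2 * g.totalEdgeCount) * (∑ k, d k : ℕ) * g.degreeCount d : ℝ) =
      ∑ w, ((if g.deg w = d then
          1 - M₁ * (((∑ k, g.deg w k : ℕ) : ℝ) / (2 * g.totalEdgeCount)) else 0) -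
            if g.deg w = d then 1 else 0) := by
    rw [Finset.sum_sub_distrib, ← hX, sum_ite_deg_eq g d fun d' =>
      1 - M₁ * (((∑ k, d' k : ℕ) : ℝ) / (2 * g.totalEdgeCount))]
    ring
  have hR : (∑ k, M₁ / (2 * g.totalEdgeCount) *
          if 0 < d k then ((d k : ℝ) - 1) * g.degreeCount (d - Pi.single k 1) else 0) =
      ∑ w, ∑ k, M₁ / (2 * g.totalEdgeCount) *
          if g.deg w + Pi.single k 1 = d then (g.deg w k : ℝ) else 0 := by
    rw [Finset.sum_comm]
    refine Finset.sum_congr rfl fun k _ => ?_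
    rw [← Finset.mul_sum, sum_ite_deg_add_single_eq]
  rw [hI, hL, hR, ← Finset.sum_add_distrib, add_sub_add_right_eq_sub, ← Finset.sum_sub_distrib]
  refine (Finset.abs_sum_le_sum_abs _ _).trans ?_
  refine (Finset.sum_le_card_nsmul _ _ _ fun w _ =>
    (le_of_eq (congrArg _ ?_)).trans (abs_integral_indicator_deg_sub_le hΛ h₁ h₂ g d w)).trans_eq ?_
  · ring
  · rw [nsmul_eq_mul, Finset.card_univ, Fintype.card_fin]

/-- The law of the degree of a new vertex. -/
theorem attachmentKernel_rowSum_eq (hΛ : Measurable Λ) (hpos : ∀ᵐ ω ∂P, 0 < Λ ω)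
    {g : TypedMultigraph N (Fin m)} (hg : 0 < g.totalEdgeCount) (d : Fin N → ℕ) :
    (attachmentKernel P Λ g).real {a | (fun k => ∑ w, a (k, w)) = d} =
      (∏ k, g.edgeProportion k ^ d k) / (∏ k, ((d k).factorial : ℝ)) *
        ∫ ω, Λ ω ^ (∑ k, d k) * Real.exp (-Λ ω) ∂P := by
  have hp : ∀ k, ((∑ w, attachmentWeight g (k, w) : ℝ≥0) : ℝ) = g.edgeProportion k := fun k => by
    rw [sum_attachmentWeight_row hg, TypedMultigraph.edgeProportion]; simp
  have hp1 : ∑ k, g.edgeProportion k = 1 := by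
    simp_rw [← hp, ← NNReal.coe_sum]
    rw [← Fintype.sum_prod_type', sum_attachmentWeight hg, NNReal.coe_one]
  rw [measureReal_def, attachmentKernel_apply hΛ, ← integral_toReal
    (f := fun ω => attachmentMeasure g (Λ ω) {a | (fun k => ∑ w, a (k, w)) = d})
    ((Measure.measurable_coe (Set.to_countable _).measurableSet).comp
      ((measurable_attachmentMeasure g).comp hΛ)).aemeasurable
    (Eventually.of_forall fun _ => measure_lt_top _ _), ← integral_const_mul]
  refine integral_congr_ae ?_
  filter_upwards [hpos] with ω hω
  rw [attachmentMeasure_rowSum_eq, ENNReal.toReal_prod]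
  simp only [poissonMeasure_singleton]
  have : ∀ k, (ENNReal.ofReal (Real.exp (-((Λ ω).toNNReal * ∑ w, attachmentWeight g (k, w) : ℝ≥0)) *
      (((Λ ω).toNNReal * ∑ w, attachmentWeight g (k, w) : ℝ≥0) : ℝ) ^ d k /
        ((d k).factorial : ℝ))).toReal =
      Real.exp (-(Λ ω * g.edgeProportion k)) * (Λ ω ^ d k * g.edgeProportion k ^ d k) /
        ((d k).factorial : ℝ) := fun k => by
    rw [ENNReal.toReal_ofReal (by positivity), NNReal.coe_mul, hp, Real.coe_toNNReal _ hω.le,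
      mul_pow]
  simp_rw [this]
  -- The proportions sum to 1, so the exponentials of the individual types multiply to exp(-Λ).
  rw [Finset.prod_div_distrib, Finset.prod_mul_distrib, Finset.prod_mul_distrib,
    Finset.prod_pow_eq_pow_sum, ← Real.exp_sum, Finset.sum_neg_distrib, ← Finset.mul_sum, hp1,
    mul_one]
  ring

end Drift

/-! ### Consequences of (IE2) for the parameters. -/

section Moments

open scoped NNReal ENNReal

variable {Ω Ω' : Type*} [mΩ : MeasurableSpace Ω] [MeasurableSpace Ω'] {P : Measure Ω}
  [IsProbabilityMeasure P] {P' : Measure Ω'} [IsProbabilityMeasure P'] {N s : ℕ}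
  {g₀ : TypedMultigraph N (Fin s)} {lam : ℕ → Ω → ℝ} {L : Ω' → ℝ}
  {G : (n : ℕ) → Ω → TypedMultigraph N (Fin (s + n))}

theorem tendsto_lintegral_ofReal (hIE2 : AssumptionIE2 P P' lam L) :
    Tendsto (fun n => ∫⁻ ω, ENNReal.ofReal (lam (n + 1) ω) ∂P) atTop
      (𝓝 (∫⁻ ω, ENNReal.ofReal (L ω) ∂P')) := by
  simpa using hIE2.tendsto_moment 1 le_rfl

/-- Convergence to finite limits controls only a tail of the sequence: early moments may be
infinite, hence the threshold n₀. -/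
theorem exists_moment_bound (hIE1 : AssumptionIE1 P lam G) (hIE2 : AssumptionIE2 P P' lam L) :
    ∃ (C : ℝ≥0) (n₀ : ℕ), ∀ n ≥ n₀, ∫⁻ ω, ENNReal.ofReal (lam (n + 1) ω) ∂P ≤ C ∧
      ∫⁻ ω, ENNReal.ofReal (lam (n + 1) ω) ^ 2 ∂P ≤ C := by
  have h1 := tendsto_lintegral_ofReal hIE2
  have f1 := hIE2.moment_lt_top 1 le_rfl
  simp only [pow_one] at f1
  have h2 := hIE2.tendsto_moment 2 (by norm_num)
  have f2 := hIE2.moment_lt_top 2 (by norm_num)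
  obtain ⟨C₁, h3, h4⟩ := ENNReal.lt_iff_exists_nnreal_btwn.1 f1
  obtain ⟨C₂, h5, h6⟩ := ENNReal.lt_iff_exists_nnreal_btwn.1 f2
  obtain ⟨n₀, hn₀⟩ := eventually_atTop.1 ((h1.eventually_lt_const h3).and
    (h2.eventually_lt_const h5))
  refine ⟨max C₁ C₂, n₀, fun n hn => ⟨(hn₀ n hn).1.le.trans (by simp), ?_⟩⟩
  refine le_trans (le_of_eq ?_) ((hn₀ n hn).2.le.trans (by simp))
  refine lintegral_congr_ae ?_
  filter_upwards [hIE1.pos n] with ω hω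
  rw [ENNReal.ofReal_pow hω.le]

theorem tendsto_toReal_lintegral (hIE2 : AssumptionIE2 P P' lam L) :
    Tendsto (fun n => (∫⁻ ω, ENNReal.ofReal (lam (n + 1) ω) ∂P).toReal) atTop
      (𝓝 (∫⁻ ω, ENNReal.ofReal (L ω) ∂P').toReal) := by
  have f1 := hIE2.moment_lt_top 1 le_rfl
  simp only [pow_one] at f1
  exact (ENNReal.tendsto_toReal f1.ne).comp (tendsto_lintegral_ofReal hIE2)

theorem toReal_lintegral_limit_pos (hIE2 : AssumptionIE2 P P' lam L) :
    0 < (∫⁻ ω, ENNReal.ofReal (L ω) ∂P').toReal := by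
  have f1 := hIE2.moment_lt_top 1 le_rfl
  simp only [pow_one] at f1
  refine ENNReal.toReal_pos ?_ f1.ne
  intro h0
  rw [lintegral_eq_zero_iff' hIE2.tendsto_distribution.aemeasurable_limit.ennreal_ofReal] at h0
  obtain ⟨ω, h1, h2⟩ := (h0.and hIE2.pos).exists
  simp only [Pi.zero_apply, ENNReal.ofReal_eq_zero] at h1
  linarith

/-- On the half-line x^D exp(-x) is continuous and bounded by D!, as x^D/D! ≤ exp(x). Replacing x by
max(x, 0) gives a bounded continuous function on the line, and positivity of the parameters makes
this harmless under the integrals. -/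
theorem tendsto_integral_pow_mul_exp (hIE1 : AssumptionIE1 P lam G)
    (hIE2 : AssumptionIE2 P P' lam L) (D : ℕ) :
    Tendsto (fun n => ∫ ω, lam (n + 1) ω ^ D * Real.exp (-lam (n + 1) ω) ∂P) atTop
      (𝓝 (∫ ω, L ω ^ D * Real.exp (-L ω) ∂P')) := by
  have hb : ∀ x : ℝ, ‖max x 0 ^ D * Real.exp (-max x 0)‖ ≤ (D.factorial : ℝ) := by
    intro x
    have h0 : 0 ≤ max x 0 := le_max_right _ _
    rw [Real.norm_of_nonneg (by positivity), Real.exp_neg, ← div_eq_mul_inv,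
      div_le_iff₀ (Real.exp_pos _), ← div_le_iff₀' (by positivity)]
    exact Real.pow_div_factorial_le_exp _ h0 D
  let f : BoundedContinuousFunction ℝ ℝ := BoundedContinuousFunction.ofNormedAddCommGroup
    (fun x => max x 0 ^ D * Real.exp (-max x 0)) (by fun_prop) _ hb
  have h := (ProbabilityMeasure.tendsto_iff_forall_integral_tendsto.1
    hIE2.tendsto_distribution.tendsto) f
  have hfm : Measurable f := f.continuous.measurable
  have e1 : ∫ x, f x ∂(P'.map L) = ∫ ω, L ω ^ D * Real.exp (-L ω) ∂P' := by
    rw [integral_map hIE2.tendsto_distribution.aemeasurable_limit hfm.aestronglyMeasurable]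
    refine integral_congr_ae ?_
    filter_upwards [hIE2.pos] with ω hω
    simp [f, hω.le]
  have e2 : ∀ n, ∫ x, f x ∂(P.map (lam (n + 1))) =
      ∫ ω, lam (n + 1) ω ^ D * Real.exp (-lam (n + 1) ω) ∂P := by
    intro n
    rw [integral_map (hIE1.measurable n).aemeasurable hfm.aestronglyMeasurable]
    refine integral_congr_ae ?_
    filter_upwards [hIE1.pos n] with ω hω
    simp [f, hω.le]
  simp only [ProbabilityMeasure.coe_mk] at h
  rw [e1] at h
  exact h.congr e2

end Moments

/-! ### Almost sure limits of edge counts, type proportions and degree counts. -/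

section Limits

open scoped NNReal ENNReal

variable {Ω Ω' : Type*} [mΩ : MeasurableSpace Ω] [MeasurableSpace Ω'] {P : Measure Ω}
  {P' : Measure Ω'} {N s : ℕ}
  {g₀ : TypedMultigraph N (Fin s)} {lam : ℕ → Ω → ℝ} {L : Ω' → ℝ}
  {G : (n : ℕ) → Ω → TypedMultigraph N (Fin (s + n))}

theorem totalEdgeCount_succ (hG : IsIndependentEdgesModel P g₀ lam G) (n : ℕ) (ω : Ω) :
    (G (n + 1) ω).totalEdgeCount = (G n ω).totalEdgeCount + ∑ i, newEdgeArray G n ω i :=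
  TypedMultigraph.totalEdgeCount_extension (hG.old_edges n ω)

theorem edgeCount_succ (hG : IsIndependentEdgesModel P g₀ lam G) (n : ℕ) (ω : Ω) (k : Fin N) :
    (G (n + 1) ω).edgeCount k = (G n ω).edgeCount k + ∑ w, newEdgeArray G n ω (k, w) :=
  TypedMultigraph.edgeCount_extension (hG.old_edges n ω) k

theorem degreeCount_succ (hG : IsIndependentEdgesModel P g₀ lam G) (n : ℕ) (ω : Ω)
    (d : Fin N → ℕ) :
    ((G (n + 1) ω).degreeCount d : ℝ) =
      (G n ω).degreeCount d + degreeCountIncrement d (G n ω) (newEdgeArray G n ω) := by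
  have h := TypedMultigraph.degreeCount_extension (hG.old_edges n ω) d
  have hX : ((G n ω).degreeCount d : ℝ) = ∑ w, if (G n ω).deg w = d then (1 : ℝ) else 0 := by
    simpa using (sum_ite_deg_eq (G n ω) d fun _ => 1).symm
  have h' := congrArg (Nat.cast : ℕ → ℝ) h
  push_cast at h'
  refine h'.trans ?_
  rw [degreeCountIncrement, Finset.sum_sub_distrib, hX]
  have e : ∀ a b c : ℝ, a + b = c + (a - c + b) := by intros; ring
  simp only [newEdgeArray, newEdges]
  rw [← e]
  congr!

theorem totalEdgeCount_pos (hG : IsIndependentEdgesModel P g₀ lam G)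
    (hg₀ : 0 < g₀.totalEdgeCount) (n : ℕ) (ω : Ω) : 0 < (G n ω).totalEdgeCount := by
  induction n with
  | zero => rwa [hG.initial ω]
  | succ n ih =>
    rw [totalEdgeCount_succ hG]
    omega

theorem edgeProportion_nonneg {m : ℕ} (g : TypedMultigraph N (Fin m)) (k : Fin N) :
    0 ≤ g.edgeProportion k := by
  unfold TypedMultigraph.edgeProportion
  positivity

theorem edgeProportion_le_one {m : ℕ} (g : TypedMultigraph N (Fin m)) (k : Fin N) :
    g.edgeProportion k ≤ 1 := by
  refine div_le_one_of_le₀ ?_ (Nat.cast_nonneg _)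
  exact_mod_cast Finset.single_le_sum (f := g.edgeCount) (fun _ _ => Nat.zero_le _)
    (Finset.mem_univ k)

theorem measurable_edgeProportion (hG : IsIndependentEdgesModel P g₀ lam G) (k : Fin N) (n : ℕ) :
    Measurable[graphHistory G n] fun ω => (G n ω).edgeProportion k :=
  (measurable_from_top (f := fun g : TypedMultigraph N (Fin (s + n)) => g.edgeProportion k)).comp
    (measurable_graphHistory hG n)

variable [IsProbabilityMeasure P]

/-- The proportion of the edges of one type is a martingale. -/
theorem martingale_edgeProportion (hG : IsIndependentEdgesModel P g₀ lam G)
    (hg₀ : 0 < g₀.totalEdgeCount) (hIE1 : AssumptionIE1 P lam G) (k : Fin N) :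
    Martingale (fun n ω => (G n ω).edgeProportion k) (graphFiltration hG) P := by
  have hint : ∀ n, Integrable (fun ω => (G n ω).edgeProportion k) P := fun n =>
    Integrable.of_bound ((measurable_edgeProportion hG k n).mono
      (graphHistory_le hG n) le_rfl).aestronglyMeasurable 1 (Eventually.of_forall fun ω => by
        rw [Real.norm_of_nonneg (edgeProportion_nonneg _ _)]
        exact edgeProportion_le_one _ _)
  refine martingale_nat (fun n => (measurable_edgeProportion hG k n).stronglyMeasurable) hint
    fun n => ?_
  set F : TypedMultigraph N (Fin (s + n)) → (Fin N × Fin (s + n) → ℕ) → ℝ := fun g a =>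
    ((g.edgeCount k + ∑ w, a (k, w) : ℕ) : ℝ) / ((g.totalEdgeCount + ∑ i, a i : ℕ) : ℝ) with hF
  have hp : (fun ω => (G (n + 1) ω).edgeProportion k) = fun ω =>
      F (G n ω) (newEdgeArray G n ω) := by
    funext ω
    rw [hF, TypedMultigraph.edgeProportion, totalEdgeCount_succ hG, edgeCount_succ hG]
  have h := condExp_newEdgeArray hG hIE1 n F (hp ▸ hint (n + 1))
  rw [hp]
  refine EventuallyEq.symm (h.trans (Eventually.of_forall fun ω => ?_))
  have hE := totalEdgeCount_pos hG hg₀ n ω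
  have h1 := lintegral_edgeProportion_attachmentKernel (P := P) (hIE1.measurable n) (G n ω) hE k
  simp only [hF]
  rw [integral_eq_lintegral_of_nonneg_ae (Eventually.of_forall fun a => by positivity)
    (measurable_of_countable _).aestronglyMeasurable]
  have h2 : ∀ a : Fin N × Fin (s + n) → ℕ,
      ENNReal.ofReal ((((G n ω).edgeCount k + ∑ w, a (k, w) : ℕ) : ℝ) /
        (((G n ω).totalEdgeCount + ∑ i, a i : ℕ) : ℝ)) =
      (((G n ω).edgeCount k + ∑ w, a (k, w) : ℕ) : ℝ≥0∞) *
        (((G n ω).totalEdgeCount + ∑ i, a i : ℕ) : ℝ≥0∞)⁻¹ := fun a => by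
    rw [ENNReal.ofReal_div_of_pos (Nat.cast_pos.2 (by omega)), ENNReal.ofReal_natCast,
      ENNReal.ofReal_natCast, div_eq_mul_inv]
  simp_rw [h2]
  rw [h1, sum_attachmentWeight_row hE, TypedMultigraph.edgeProportion]
  simp

theorem ae_exists_tendsto_edgeProportion (hG : IsIndependentEdgesModel P g₀ lam G)
    (hg₀ : 0 < g₀.totalEdgeCount) (hIE1 : AssumptionIE1 P lam G) (k : Fin N) :
    ∀ᵐ ω ∂P, ∃ c, Tendsto (fun n => (G n ω).edgeProportion k) atTop (𝓝 c) := by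
  refine (martingale_edgeProportion hG hg₀ hIE1 k).submartingale.exists_ae_tendsto_of_bdd
    (R := 1) fun n => ?_
  refine (eLpNorm_le_of_ae_bound (C := 1) (Eventually.of_forall fun ω => ?_)).trans (by simp)
  rw [Real.norm_of_nonneg (edgeProportion_nonneg _ _)]
  exact edgeProportion_le_one _ _

variable [IsProbabilityMeasure P']

theorem ae_tendsto_average_of_abs_le (hG : IsIndependentEdgesModel P g₀ lam G)
    (hIE1 : AssumptionIE1 P lam G) (hIE2 : AssumptionIE2 P P' lam L)
    (F : ∀ n, TypedMultigraph N (Fin (s + n)) → (Fin N × Fin (s + n) → ℕ) → ℝ)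
    (hF : ∀ n g a, |F n g a| ≤ (∑ i, a i : ℕ) + 1) :
    ∀ᵐ ω ∂P, Tendsto (fun n : ℕ => (n : ℝ)⁻¹ * ∑ i ∈ Finset.range n,
      (F i (G i ω) (newEdgeArray G i ω) -
        ∫ a, F i (G i ω) a ∂(attachmentKernel P (lam (i + 1)) (G i ω)))) atTop (𝓝 0) := by
  obtain ⟨C, n₀, hC⟩ := exists_moment_bound hIE1 hIE2
  exact ae_tendsto_average_sub_integral hG hIE1 F (4 * C + 1) n₀ fun n hn ω =>
    lintegral_sq_attachmentKernel_le (hIE1.measurable n) (hC n hn).1 (hC n hn).2 _ (hF n _)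

theorem ae_tendsto_totalEdgeCount_div (hs : 0 < s) (hG : IsIndependentEdgesModel P g₀ lam G)
    (hg₀ : 0 < g₀.totalEdgeCount)
    (hIE1 : AssumptionIE1 P lam G) (hIE2 : AssumptionIE2 P P' lam L) :
    ∀ᵐ ω ∂P, Tendsto (fun n => ((G n ω).totalEdgeCount : ℝ) / (s + n : ℕ)) atTop
      (𝓝 (∫⁻ ω, ENNReal.ofReal (L ω) ∂P').toReal) := by
  filter_upwards [ae_tendsto_average_of_abs_le hG hIE1 hIE2
    (fun n _ a => ((∑ i, a i : ℕ) : ℝ)) fun n _ a => by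
      rw [abs_of_nonneg (Nat.cast_nonneg _)]; linarith] with ω hω
  have hI : ∀ n, ∫ a, ((∑ i, a i : ℕ) : ℝ) ∂(attachmentKernel P (lam (n + 1)) (G n ω)) =
      (∫⁻ ω, ENNReal.ofReal (lam (n + 1) ω) ∂P).toReal := fun n => by
    rw [integral_natCast_eq_toReal_lintegral,
      lintegral_sum_attachmentKernel (P := P) (hIE1.measurable n),
      sum_attachmentWeight (totalEdgeCount_pos hG hg₀ n ω)]
    simp
  simp_rw [hI] at hω
  -- No edges are lost, so α = 0 and the limit is that of the mean number of new edges.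
  have h := tendsto_div_of_recursion (a := 0) (Y := fun n => ((G n ω).totalEdgeCount : ℝ)) le_rfl hs
    (fun _ => le_rfl) tendsto_const_nhds (tendsto_toReal_lintegral hIE2) hω fun n => by
      rw [totalEdgeCount_succ hG]
      push_cast
      simp
  simpa using h

/-- On a path along which the laws of large numbers hold, the proportion of vertices of degree `d`
converges as soon as the proportions of vertices of the preceding degrees do. -/
theorem tendsto_degreeCount_div (hs : 0 < s) (hG : IsIndependentEdgesModel P g₀ lam G)
    (hg₀ : 0 < g₀.totalEdgeCount)
    (hIE1 : AssumptionIE1 P lam G) (hIE2 : AssumptionIE2 P P' lam L) {ω : Ω}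
    (hE : Tendsto (fun n => ((G n ω).totalEdgeCount : ℝ) / (s + n : ℕ)) atTop
      (𝓝 (∫⁻ ω, ENNReal.ofReal (L ω) ∂P').toReal))
    {z : Fin N → ℝ} (hz : ∀ k, Tendsto (fun n => (G n ω).edgeProportion k) atTop (𝓝 (z k)))
    (d : Fin N → ℕ)
    (hD : Tendsto (fun n : ℕ => (n : ℝ)⁻¹ * ∑ i ∈ Finset.range n,
      (degreeCountIncrement d (G i ω) (newEdgeArray G i ω) -
        ∫ a, degreeCountIncrement d (G i ω) a ∂(attachmentKernel P (lam (i + 1)) (G i ω))))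
      atTop (𝓝 0))
    {y : (Fin N → ℕ) → ℝ} (hy : ∀ k, 0 < d k →
      Tendsto (fun n => ((G n ω).degreeCount (d - Pi.single k 1) : ℝ) / (s + n : ℕ)) atTop
        (𝓝 (y (d - Pi.single k 1)))) :
    Tendsto (fun n => ((G n ω).degreeCount d : ℝ) / (s + n : ℕ)) atTop
      (𝓝 (∑ k, ((d k : ℝ) - 1) / ((∑ j, d j : ℕ) + 2 : ℝ) *
              (if 0 < d k then y (d - Pi.single k 1) else 0) +
            2 / ((∑ j, d j : ℕ) + 2 : ℝ) *
              ((∏ k, z k ^ d k) / (∏ k, ((d k).factorial : ℝ))) *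
              ∫ ω', L ω' ^ (∑ j, d j) * Real.exp (-L ω') ∂P')) := by
  have hμ := toReal_lintegral_limit_pos hIE2
  have hM := tendsto_toReal_lintegral hIE2
  obtain ⟨C, n₀, hC⟩ := exists_moment_bound hIE1 hIE2
  set μ := (∫⁻ ω, ENNReal.ofReal (L ω) ∂P').toReal with hμdef
  set M : ℕ → ℝ := fun n => (∫⁻ ω, ENNReal.ofReal (lam (n + 1) ω) ∂P).toReal with hMdef
  set D : ℝ := ((∑ j, d j : ℕ) : ℝ) with hDdef
  set t : ℕ → ℝ := fun n => ((s + n : ℕ) : ℝ) with ht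
  have htpos : ∀ n, 0 < t n := fun n => by
    have : 0 < s + n := by omega
    exact Nat.cast_pos.2 this
  have httop : Tendsto t atTop atTop :=
    tendsto_natCast_atTop_atTop.comp (tendsto_atTop_mono (fun n => Nat.le_add_left n s) tendsto_id)
  set E : ℕ → ℝ := fun n => ((G n ω).totalEdgeCount : ℝ) with hEdef
  have hEpos : ∀ n, 0 < E n := fun n => by
    exact Nat.cast_pos.2 (totalEdgeCount_pos hG hg₀ n ω)
  set X : (Fin N → ℕ) → ℕ → ℝ := fun d n => ((G n ω).degreeCount d : ℝ) with hX
  set K : ℕ → ℝ := fun n =>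
    ∫ a, degreeCountIncrement d (G n ω) a ∂(attachmentKernel P (lam (n + 1)) (G n ω)) with hK
  -- the normalized attachment rate per half-edge
  set ρ : ℕ → ℝ := fun n => M n / (2 * (E n / t n)) with hρ
  have hρlim : Tendsto ρ atTop (𝓝 (1 / 2)) := by
    have h := hM.div (hE.const_mul 2) (by positivity)
    have e : μ / (2 * μ) = 1 / 2 := by field_simp
    rwa [e] at h
  have hρeq : ∀ n x, M n / (2 * E n) * x = ρ n * (x / t n) := fun n x => by
    have h1 := (htpos n).ne'
    have h2 := (hEpos n).ne'
    simp only [hρ]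
    field_simp
  set q : ℕ → ℝ := fun n =>
    (∏ k, (G n ω).edgeProportion k ^ d k) / (∏ k, ((d k).factorial : ℝ)) *
      ∫ ω, lam (n + 1) ω ^ (∑ k, d k) * Real.exp (-lam (n + 1) ω) ∂P with hq
  have hqlim : Tendsto q atTop (𝓝 ((∏ k, z k ^ d k) / (∏ k, ((d k).factorial : ℝ)) *
      ∫ ω', L ω' ^ (∑ j, d j) * Real.exp (-L ω') ∂P')) :=
    ((tendsto_finsetProd _ fun k _ => (hz k).pow (d k)).div_const _).mul
      (tendsto_integral_pow_mul_exp hIE1 hIE2 _)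
  set S : ℕ → ℝ := fun n => ∑ k, ρ n *
    if 0 < d k then ((d k : ℝ) - 1) * (X (d - Pi.single k 1) n / t n) else 0 with hS
  have hSlim : Tendsto S atTop (𝓝 (∑ k, 1 / 2 *
      if 0 < d k then ((d k : ℝ) - 1) * y (d - Pi.single k 1) else 0)) := by
    refine tendsto_finsetSum _ fun k _ => hρlim.mul ?_
    split_ifs with hk
    · exact (hy k hk).const_mul _
    · exact tendsto_const_nhds
  -- There are t_n vertices, each with an error of order 1/t_n² because the edge count grows
  -- linearly; a factor 1/t_n survives.
  have hdrift : ∀ n ≥ n₀, |K n + ρ n * D * (X d n / t n) - (S n + q n)| ≤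
      C * (D / (2 * (E n / t n))) ^ 2 / t n := by
    intro n hn
    have hpos := totalEdgeCount_pos hG hg₀ n ω
    have m1 : ∫⁻ ω, ENNReal.ofReal (lam (n + 1) ω) ∂P = ((M n).toNNReal : ℝ≥0∞) :=
      (ENNReal.ofReal_toReal ((hC n hn).1.trans_lt ENNReal.coe_lt_top).ne).symm
    have m2 : ∫⁻ ω, ENNReal.ofReal (lam (n + 1) ω) ^ 2 ∂P =
        ((∫⁻ ω, ENNReal.ofReal (lam (n + 1) ω) ^ 2 ∂P).toNNReal : ℝ≥0∞) :=
      (ENNReal.coe_toNNReal ((hC n hn).2.trans_lt ENNReal.coe_lt_top).ne).symm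
    have h := abs_integral_degreeCountIncrement_sub_le (hIE1.measurable n) m1 m2 (G n ω) d
    rw [attachmentKernel_rowSum_eq (hIE1.measurable n) (hIE1.pos n) hpos,
      Real.coe_toNNReal _ ENNReal.toReal_nonneg] at h
    have e1 : ∀ k, M n / (2 * E n) *
        (if 0 < d k then ((d k : ℝ) - 1) * X (d - Pi.single k 1) n else 0) =
        ρ n * if 0 < d k then ((d k : ℝ) - 1) * (X (d - Pi.single k 1) n / t n) else 0 := by
      intro k
      rw [hρeq]
      split_ifs
      · rw [mul_div_assoc]
      · simp
    have e2 : M n / (2 * E n) * D * X d n = ρ n * D * (X d n / t n) := by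
      rw [mul_assoc, hρeq]; ring
    change |K n - (-(M n / (2 * E n) * D * X d n) + (∑ k, M n / (2 * E n) *
      (if 0 < d k then ((d k : ℝ) - 1) * X (d - Pi.single k 1) n else 0)) + q n)| ≤ _ at h
    rw [e2, Finset.sum_congr rfl fun k _ => e1 k] at h
    have e3 : K n + ρ n * D * (X d n / t n) - (S n + q n) =
        K n - (-(ρ n * D * (X d n / t n)) + S n + q n) := by ring
    rw [e3]
    refine h.trans ?_
    change t n * (_ * (D / (2 * E n)) ^ 2) ≤ _
    have e4 : (C : ℝ) * (D / (2 * (E n / t n))) ^ 2 / t n = t n * (C * (D / (2 * E n)) ^ 2) := by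
      have h1 := (htpos n).ne'
      have h2 := (hEpos n).ne'
      field_simp
    rw [e4]
    have h5 : ((∫⁻ ω, ENNReal.ofReal (lam (n + 1) ω) ^ 2 ∂P).toNNReal : ℝ) ≤ C := by
      have := (hC n hn).2
      rw [m2] at this
      exact_mod_cast this
    have := (htpos n).le
    gcongr
  have herr : Tendsto (fun n => K n + ρ n * D * (X d n / t n) - (S n + q n)) atTop (𝓝 0) := by
    have h1 : Tendsto (fun n => (C : ℝ) * (D / (2 * (E n / t n))) ^ 2 / t n) atTop (𝓝 0) :=
      (((tendsto_const_nhds.div (hE.const_mul 2) (by positivity)).pow 2).const_mul _).div_atTop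
        httop
    refine squeeze_zero_norm' ?_ h1
    filter_upwards [eventually_ge_atTop n₀] with n hn
    exact hdrift n hn
  have hb : Tendsto (fun n => K n + ρ n * D * (X d n / t n)) atTop
      (𝓝 ((∑ k, 1 / 2 * if 0 < d k then ((d k : ℝ) - 1) * y (d - Pi.single k 1) else 0) +
        (∏ k, z k ^ d k) / (∏ k, ((d k).factorial : ℝ)) *
          ∫ ω', L ω' ^ (∑ j, d j) * Real.exp (-L ω') ∂P')) := by
    have := herr.add (hSlim.add hqlim)
    rw [zero_add] at this
    exact this.congr fun n => by ring
  -- Here α = D/2, and dividing by 1 + D/2 = (D + 2)/2 produces the denominators D + 2 and the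
  -- factor 2 of the new-vertex term.
  have hfinal := tendsto_div_of_recursion (Y := X d) (a := fun n => ρ n * D)
    (by positivity : 0 ≤ 1 / 2 * D) hs
    (fun n => by
      have := hEpos n
      have := htpos n
      positivity) (hρlim.mul_const D) hb hD
    (fun n => by
      simp only [hX]
      rw [degreeCount_succ hG]
      ring)
  convert hfinal using 2
  have hD2 : D + 2 ≠ 0 := by positivity
  have hD3 : 1 + 1 / 2 * D = (D + 2) / 2 := by ring
  rw [hD3, add_div, Finset.sum_div]
  congr 1
  · refine Finset.sum_congr rfl fun k _ => ?_
    split_ifs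
    · field_simp
    · simp
  · field_simp

end Limits

/-! ### Existence of the limits and their recursion. -/

theorem mainTheorem3 {Ω Ω' : Type*} [MeasurableSpace Ω] [MeasurableSpace Ω']
    (P : Measure Ω) [IsProbabilityMeasure P] (P' : Measure Ω') [IsProbabilityMeasure P']
    {N s : ℕ} (hN : 1 ≤ N)
    (g₀ : TypedMultigraph N (Fin s)) (hg₀ : ∀ k, 0 < g₀.edgeCount k)
    (lam : ℕ → Ω → ℝ) (L : Ω' → ℝ)
    (G : (n : ℕ) → Ω → TypedMultigraph N (Fin (s + n)))
    (hG : IsIndependentEdgesModel P g₀ lam G)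
    (hlam : iIndepFun (fun n => lam (n + 1)) P)
    (hIE1 : AssumptionIE1 P lam G)
    (hIE2 : AssumptionIE2 P P' lam L) :
    ∃ (ζ : Fin N → Ω → ℝ) (x : (Fin N → ℕ) → Ω → ℝ),
      (∀ k, Measurable (ζ k)) ∧
      (∀ k, ∀ᵐ ω ∂P, Tendsto (fun n => (G n ω).edgeProportion k) atTop (𝓝 (ζ k ω))) ∧
      (∀ d, Measurable (x d)) ∧
      (∀ d, ∀ᵐ ω ∂P,
        Tendsto (fun n => ((G n ω).degreeCount d : ℝ) / (Fintype.card (Fin (s + n)) : ℝ))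
          atTop (𝓝 (x d ω))) ∧
      (∀ d, ∀ᵐ ω ∂P,
        x d ω =
          ∑ k, ((d k : ℝ) - 1) / ((∑ j, d j : ℕ) + 2 : ℝ) *
              (if 0 < d k then x (d - Pi.single k 1) ω else 0) +
            2 / ((∑ j, d j : ℕ) + 2 : ℝ) *
              ((∏ k, ζ k ω ^ d k) / (∏ k, ((d k).factorial : ℝ))) *
              ∫ ω', L ω' ^ (∑ j, d j) * Real.exp (-L ω') ∂P') := by
  have hk₀ := hg₀ ⟨0, hN⟩
  have hpos : 0 < g₀.totalEdgeCount := hk₀.trans_le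
    (Finset.single_le_sum (f := g₀.edgeCount) (fun _ _ => Nat.zero_le _) (Finset.mem_univ _))
  have hs : 0 < s := by
    rcases Nat.eq_zero_or_pos s with rfl | h
    · exact absurd hk₀ (by simp [TypedMultigraph.edgeCount])
    · exact h
  simp only [Fintype.card_fin]
  have hζ := fun k => measurable_limit_of_tendsto_metrizable_ae
    (fun n => ((measurable_edgeProportion hG k n).mono (graphHistory_le hG n) le_rfl).aemeasurable)
    (ae_exists_tendsto_edgeProportion hG hpos hIE1 k)
  choose ζ hζm hζt using hζ
  have hE := ae_tendsto_totalEdgeCount_div hs hG hpos hIE1 hIE2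
  have hD : ∀ d : Fin N → ℕ, _ := fun d => ae_tendsto_average_of_abs_le hG hIE1 hIE2
    (fun _ => degreeCountIncrement d) fun _ => abs_degreeCountIncrement_le d
  have hstep := fun {ω : Ω} (h1 : ∀ k, Tendsto (fun n => (G n ω).edgeProportion k) atTop
      (𝓝 (ζ k ω))) h2 d h3 (y : (Fin N → ℕ) → ℝ) =>
    tendsto_degreeCount_div hs hG hpos hIE1 hIE2 (ω := ω) h2 h1 d h3 (y := y)
  have hex : ∀ᵐ ω ∂P, ∀ d : Fin N → ℕ, ∃ c,
      Tendsto (fun n => ((G n ω).degreeCount d : ℝ) / (s + n : ℕ)) atTop (𝓝 c) := by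
    filter_upwards [ae_all_iff.2 hζt, hE, ae_all_iff.2 hD] with ω h1 h2 h3 d
    -- Pathwise induction on the total degree. At total 0 there are no predecessors, so the value 0
    -- given for `y` is irrelevant.
    induction h : ∑ k, d k generalizing d with
    | zero =>
      refine ⟨_, hstep h1 h2 d (h3 d) 0 fun k hk => ?_⟩
      have := Finset.sum_eq_zero_iff.1 h k (Finset.mem_univ k)
      omega
    | succ D ih =>
      have hpred : ∀ k, 0 < d k → ∃ c, Tendsto (fun n =>
          ((G n ω).degreeCount (d - Pi.single k 1) : ℝ) / (s + n : ℕ)) atTop (𝓝 c) := by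
        intro k hk
        refine ih _ ?_
        have h4 : d - Pi.single k 1 + Pi.single k 1 = d := by
          funext j
          by_cases hj : j = k
          · subst hj; simp; omega
          · simp [Pi.single_eq_of_ne hj]
        have h5 : ∑ j, (d - Pi.single k 1 + Pi.single k 1 : Fin N → ℕ) j = D + 1 := by rw [h4, h]
        simpa only [Pi.add_apply, Finset.sum_add_distrib, Finset.sum_pi_single',
          Finset.mem_univ, if_true, add_left_inj] using h5
      classical
      -- The limits at the predecessors are picked by choice; the default 0 is never used there.
      refine ⟨_, hstep h1 h2 d (h3 d) (fun d' => if h : ∃ c, Tendsto (fun n =>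
          ((G n ω).degreeCount d' : ℝ) / (s + n : ℕ)) atTop (𝓝 c) then h.choose else 0)
        fun k hk => ?_⟩
      rw [dif_pos (hpred k hk)]
      exact (hpred k hk).choose_spec
  have hx := fun d : Fin N → ℕ => measurable_limit_of_tendsto_metrizable_ae
    (f := fun n ω => ((G n ω).degreeCount d : ℝ) / (s + n : ℕ)) (L := atTop) (μ := P)
    (fun n => ((measurable_from_top (f := fun g : TypedMultigraph N (Fin (s + n)) =>
      (g.degreeCount d : ℝ) / (s + n : ℕ))).comp (hG.measurable_graph n)).aemeasurable)
    (by filter_upwards [hex] with ω h using h d)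
  choose x hxm hxt using hx
  refine ⟨ζ, x, hζm, hζt, hxm, hxt, fun d => ?_⟩
  filter_upwards [ae_all_iff.2 hζt, hE, hD d, ae_all_iff.2 hxt] with ω h1 h2 h3 h4
  -- The measurable limits `x` exist by now for all of the countably many degrees at once, so the
  -- recursion is uniqueness of the limit at d.
  exact tendsto_nhds_unique (h4 d) (hstep h1 h2 d h3 (fun d' => x d' ω) fun k _ => h4 _)
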